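/- Let $p$ be an odd prime, $n\ge 2$, $1\le k<n$, $q=p^n$, $d=\gcd(n,k)$, $e=\gcd(n,2k)$. Let $F(x)=x^{p^k+1}$, let $P(x)=\sum_{i=0}^{n-1}a_ix^{p^i}$ be an arbitrary linearized polynomial over $\mathbb F_q$, $G=F+P$, and let $a,b,c\in\mathbb F_q$. Let ${}_c\Delta_G(a,b)=\#\{x\in\mathbb F_q: G(x+a)-cG(x)=b\}$. Notation. $\chi_1(x)=\exp(2\pi i\,\mathrm{Tr}(x)/p)$ with $\mathrm{Tr}:\mathbb F_q\to\mathbb F_p$ the absolute trace; $\eta$ is the quadratic character of $\mathbb F_q$ ($\eta(0)=0$). Put $P'(a)=P(a)+a^{p^k+1}$, $P^*(x)=\sum_{i=0}^{n-1}((1-c)a_i)^{p^{n-i}}x^{p^{n-i}}$ and, for $\alpha\in\mathbb F_q^*$, $A_\alpha=\alpha(1-c)$, $B_\alpha=\sum_{i=0}^{n-1}(a_i')^{p^{n-i}}$, where $a_0'=\alpha a^{p^k}+A_\alpha a_0$, $a_k'=\alpha(a+(1-c)a_k)$ and $a_i'=A_\alpha a_i$ for $i\ne 0,k$; $L_\alpha(x)=A_\alpha^{p^k}x^{p^{2k}}+A_\alpha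 x$; $S_\alpha=\sum_{x\in\mathbb F_q}\chi_1(A_\alpha x^{p^k+1}+B_\alpha x)$; $T_{a,b}=\sum_{\alpha\in\mathbb F_q^*}\chi_1(\alpha(P'(a)-b))\,S_\alpha$. With $y^{p^{-k}}$ the $p^k$-th root of $y$ in $\mathbb F_q$, let $$X_a=\{\alpha\in\mathbb F_q^*:\ \alpha a^{p^k}+\alpha^{p^{-k}}a^{p^{-k}}+P^*(\alpha)=0\},\qquad \bar X_a=\mathbb F_q^*\setminus X_a .$$ If $n/d$ is even, let $V_a=\{\alpha\in\bar X_a: A_\alpha^{(q-1)/(p^d+1)}\ne(-1)^{n/(2d)}\}$ and $W_a=\{\alpha\in X_a: A_\alpha^{(q-1)/(p^d+1)}\neq(-1)^{n/(2d)}\}$; if $n/d$ is odd, let $V_a=\{\alpha\in\bar X_a: A_\alpha^{(p^k-1)(q-1)/(p^e-1)}\ne(-1)^{n/e}\}$. Let $\Sigma=\sum_{\alpha\in X_a}\chi_1(\alpha(P'(a)-b))$ and, for $n/d$ even, $\Sigma_1=\sum_{\alpha\in X_a\setminus W_a}\chi_1(\alpha(P'(a)-b))$. Say that $\alpha$ satisfies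 $(\mathcal P)$ if $L_\alpha(x)=B_\alpha^{p^k}$ has a solution $x\in\mathbb F_q$; then let $x_\alpha$ be any such solution (otherwise any element of $\mathbb F_q$), and $\delta_\alpha=P'(a)-b-(1-c)x_\alpha^{p^k+1}$. Let $\epsilon_p=\mu_p=1$ if $p\equiv1\pmod 4$, and $\epsilon_p=i^{n}$, $\mu_p=i^{3n}$ if $p\equiv3\pmod 4$. For $U\subseteq\mathbb F_q^*$ let $G_U(\eta,\chi_{\delta_\alpha})=\sum_{\alpha\in U}\eta(\alpha)\chi_1(\delta_\alpha\alpha)$ and, for $\beta\in\mathbb F_q$, $G_U(\eta,\chi_\beta)=\sum_{\alpha\in U}\eta(\alpha)\chi_1(\beta\alpha)$. Then ${}_c\Delta_G(a,b)=1+p^{-n}T_{a,b}$, and: (i) If $n/d$ is even, $n=2m$, and $c\ne1$, then the equation $L_\alpha(x)=B_\alpha^{p^k}$ has exactly one solution for every $\alpha\in V_a$, and $$T_{a,b}=(-1)^{\frac md}p^m\,\Sigma+(-1)^{\frac md+1}p^m\,\Sigma_1(p^d+1)+(-1)^{\frac md}p^m\sum_{\alpha\in V_a}\chi_1(\alpha\delta_\alpha)+(-1)^{\frac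 md+1}p^{m+d}\sum_{\substack{\alpha\in\bar X_a\setminus V_a\\ \alpha\text{ satisfies }(\mathcal P)}}\chi_1(\alpha\delta_\alpha).$$ (ii) If $n/d$ is odd and $(c,a)\ne(1,0)$, then $$T_{a,b}=(-1)^{n-1}\epsilon_p\,p^{n/2}\,\eta(1-c)\,G_{X_a}(\eta,\chi_{P'(a)-b})+(-1)^{n-1}\mu_p\,p^{n/2}\,\eta(c-1)\,G_{V_a}(\eta,\chi_{\delta_\alpha}),$$ and, if $c\ne1$, the equation $L_\alpha(x)=B_\alpha^{p^k}$ has exactly one solution for every $\alpha\in V_a$. (iii) If $c=1$, then $T_{a,b}=p^n\,\Sigma$. -/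

import Mathlib

open Finset

noncomputable section

open scoped Classical in
/-- The entry at `(a, b)` of the `c`-Difference Distribution Table of `G : F → F`, i.e. the number
of `x` with `G (x + a) - c * G x = b`. -/
def cDDT {F : Type*} [Field F] [Fintype F] (G : F → F) (c a b : F) : ℕ :=
  (univ.filter fun x : F => G (x + a) - c * G x = b).card

/-- The principal additive character `x ↦ exp (2 π i Tr x / p)`, with the absolute trace. -/
def chiOne (p : ℕ) [Fact p.Prime] {F : Type*} [Field F] [Fintype F] [Algebra (ZMod p) F] :
    AddChar F ℂ :=
  ZMod.stdAddChar.compAddMonoidHom (Algebra.trace (ZMod p) F).toAddMonoidHom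

open scoped Classical in
/-- The quadratic character of `F`, with complex values; it is `0` at `0`. -/
def etaChar {F : Type*} [Field F] [Fintype F] (x : F) : ℂ := ((quadraticChar F x : ℤ) : ℂ)

/-- Incomplete Gauss sum over `U`. Here `χ` is just a function, since it is also used for
`α ↦ χ₁ (δ_α * α)`, where `δ_α` varies with `α`. -/
def incGaussSum {F : Type*} (U : Finset F) (ψ χ : F → ℂ) : ℂ := ∑ α ∈ U, ψ α * χ α

/-- The linearized polynomial function `P(x) = ∑_{i < n} u_i x^{p^i}`. -/
def linPoly (p n : ℕ) {F : Type*} [Field F] (u : ℕ → F) (x : F) : F :=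
  ∑ i ∈ range n, u i * x ^ p ^ i

/-- The perturbed Gold function `G(x) = x^{p^k+1} + P(x)`. -/
def pertGold (p n k : ℕ) {F : Type*} [Field F] (u : ℕ → F) (x : F) : F :=
  x ^ (p ^ k + 1) + linPoly p n u x

/-- `P'(a) = P(a) + a^{p^k+1}`. -/
def pPrime (p n k : ℕ) {F : Type*} [Field F] (u : ℕ → F) (a : F) : F :=
  linPoly p n u a + a ^ (p ^ k + 1)

/-- The linearized `c`-companion polynomial `P^*` of `P`. -/
def companion (p n : ℕ) {F : Type*} [Field F] (u : ℕ → F) (c x : F) : F :=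
  ∑ i ∈ range n, ((1 - c) * u i) ^ p ^ (n - i) * x ^ p ^ (n - i)

/-- `A_α = α (1 - c)`. -/
def coefA {F : Type*} [Field F] (c α : F) : F := α * (1 - c)

/-- The coefficients `a_i'`. -/
def coefPrime (p k : ℕ) {F : Type*} [Field F] (u : ℕ → F) (c a α : F) (i : ℕ) : F :=
  if i = 0 then α * a ^ p ^ k + coefA c α * u 0
  else if i = k then α * (a + (1 - c) * u k)
  else coefA c α * u i

/-- `B_α = ∑_{i < n} (a_i')^{p^{n-i}}`. -/
def coefB (p n k : ℕ) {F : Type*} [Field F] (u : ℕ → F) (c a α : F) : F :=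
  ∑ i ∈ range n, coefPrime p k u c a α i ^ p ^ (n - i)

/-- `L_α(x) = A_α^{p^k} x^{p^{2k}} + A_α x`. -/
def polyL (p k : ℕ) {F : Type*} [Field F] (c α x : F) : F :=
  coefA c α ^ p ^ k * x ^ p ^ (2 * k) + coefA c α * x

/-- `y` solves `L_α(y) = B_α^{p^k}`. -/
def IsSolL (p n k : ℕ) {F : Type*} [Field F] (u : ℕ → F) (c a α y : F) : Prop :=
  polyL p k c α y = coefB p n k u c a α ^ p ^ k

/-- `δ_α = P'(a) - b - (1 - c) x_α^{p^k+1}`, where `x` is the family `α ↦ x_α`. -/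
def deltaC (p n k : ℕ) {F : Type*} [Field F] (u : ℕ → F) (c a b : F) (x : F → F) (α : F) : F :=
  pPrime p n k u a - b - (1 - c) * x α ^ (p ^ k + 1)

section sets

open scoped Classical in
/-- `X_a = {α ≠ 0 : α a^{p^k} + α^{p^{-k}} a^{p^{-k}} + P^*(α) = 0}`. In a field with `p^n`
elements and for `k ≤ n`, `y^{p^{-k}}` (the `p^k`-th root of `y`) is `y^{p^{n-k}}`. -/
def setX (p n k : ℕ) {F : Type*} [Field F] [Fintype F] (u : ℕ → F) (c a : F) : Finset F :=
  univ.filter fun α : F => α ≠ 0 ∧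
    α * a ^ p ^ k + α ^ p ^ (n - k) * a ^ p ^ (n - k) + companion p n u c α = 0

open scoped Classical in
/-- The complement of `X_a` in the set of nonzero elements. -/
def setXbar (p n k : ℕ) {F : Type*} [Field F] [Fintype F] (u : ℕ → F) (c a : F) : Finset F :=
  univ.filter fun α : F => α ≠ 0 ∧ α ∉ setX p n k u c a

open scoped Classical in
/-- `V_a` for `n / d` even, `d = gcd(n, k)` (then both divisions are exact). -/
def setVEven (p n k : ℕ) {F : Type*} [Field F] [Fintype F] (u : ℕ → F) (c a : F) : Finset F :=
  (setXbar p n k u c a).filter fun α : F =>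
    coefA c α ^ ((p ^ n - 1) / (p ^ n.gcd k + 1)) ≠ (-1) ^ (n / (2 * n.gcd k))

open scoped Classical in
/-- `V_a` for `n / d` odd, `d = gcd(n, k)`, in terms of `e = gcd(n, 2k)` (both divisions are
exact). -/
def setVOdd (p n k : ℕ) {F : Type*} [Field F] [Fintype F] (u : ℕ → F) (c a : F) : Finset F :=
  (setXbar p n k u c a).filter fun α : F =>
    coefA c α ^ ((p ^ k - 1) * ((p ^ n - 1) / (p ^ n.gcd (2 * k) - 1))) ≠
      (-1) ^ (n / n.gcd (2 * k))

open scoped Classical in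
/-- `W_a`, used for `n / d` even, `d = gcd(n, k)`. -/
def setW (p n k : ℕ) {F : Type*} [Field F] [Fintype F] (u : ℕ → F) (c a : F) : Finset F :=
  (setX p n k u c a).filter fun α : F =>
    coefA c α ^ ((p ^ n - 1) / (p ^ n.gcd k + 1)) ≠ (-1) ^ (n / (2 * n.gcd k))

open scoped Classical in
/-- `X_a \ W_a`. -/
def setXdiffW (p n k : ℕ) {F : Type*} [Field F] [Fintype F] (u : ℕ → F) (c a : F) : Finset F :=
  setX p n k u c a \ setW p n k u c a

open scoped Classical in
/-- The elements of the complement of `X_a`, outside `V_a` (`n / d` even), for which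
`L_α(y) = B_α^{p^k}` is solvable. -/
def setSolvable (p n k : ℕ) {F : Type*} [Field F] [Fintype F] (u : ℕ → F) (c a : F) : Finset F :=
  (setXbar p n k u c a \ setVEven p n k u c a).filter fun α : F =>
    ∃ y : F, IsSolL p n k u c a α y

end sets

/-- `S_α = ∑_x χ₁(A_α x^{p^k+1} + B_α x)`. -/
def weilS (p n k : ℕ) [Fact p.Prime] {F : Type*} [Field F] [Fintype F] [Algebra (ZMod p) F]
    (u : ℕ → F) (c a α : F) : ℂ :=
  ∑ x : F, chiOne p (coefA c α * x ^ (p ^ k + 1) + coefB p n k u c a α * x)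

open scoped Classical in
/-- `T_{a,b} = ∑_{α ≠ 0} χ₁(α (P'(a) - b)) S_α`. -/
def sumT (p n k : ℕ) [Fact p.Prime] {F : Type*} [Field F] [Fintype F] [Algebra (ZMod p) F]
    (u : ℕ → F) (c a b : F) : ℂ :=
  ∑ α ∈ univ.filter (fun α : F => α ≠ 0),
    chiOne p (α * (pPrime p n k u a - b)) * weilS p n k u c a α

/-- `Σ`. -/
def sigmaX (p n k : ℕ) [Fact p.Prime] {F : Type*} [Field F] [Fintype F] [Algebra (ZMod p) F]
    (u : ℕ → F) (c a b : F) : ℂ :=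
  ∑ α ∈ setX p n k u c a, chiOne p (α * (pPrime p n k u a - b))

/-- `Σ₁`. -/
def sigmaOne (p n k : ℕ) [Fact p.Prime] {F : Type*} [Field F] [Fintype F] [Algebra (ZMod p) F]
    (u : ℕ → F) (c a b : F) : ℂ :=
  ∑ α ∈ setXdiffW p n k u c a, chiOne p (α * (pPrime p n k u a - b))

/-- `ε_p`: `1` if `p ≡ 1 (mod 4)` and `i^n` if `p ≡ 3 (mod 4)`. -/
def epsP (p n : ℕ) : ℂ := if p % 4 = 1 then 1 else Complex.I ^ n

/-- `μ_p`: `1` if `p ≡ 1 (mod 4)` and `i^{3n}` if `p ≡ 3 (mod 4)`. -/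
def muP (p n : ℕ) : ℂ := if p % 4 = 1 then 1 else Complex.I ^ (3 * n)

end

/-! Orthogonality of additive characters writes `q` times the number of solutions as a double sum
over `α` and `x`. The term `α = 0` gives `q`. For `α ≠ 0`, every term of the exponent additive in
`x` is moved, by trace invariance under Frobenius, into the single linear term `B_α x`; what remains
is the Weil sum `S_α`, and `B_α` is exactly the expression defining `X_a`, so `X_a = {α ≠ 0 : B_α =
0}`.

For `A ≠ 0` the sum `S(A, B) = ∑ χ₁(A x^{p^k+1} + B x)` belongs to the quadratic form `Tr(A
x^{p^k+1})`, whose polar form is `Tr(y^{p^k} L_A(x))`. If `L_A(y) = B^{p^k}`, completing the square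
gives `S(A, B) = χ₁(-A y^{p^k+1}) S(A, 0)`; if there is no such `y`, the sum vanishes. Moreover
`|S(A, 0)|² = q · #ker L_A`, and the kernel is counted from a power-residue condition on `A`, the
one defining `V_a` and `W_a`.

It remains to find the phase of `S(A, 0)`. If `n/d` is even, some `w` has `w^{p^k+1} = -1`, so the
sum is real, hence plus or minus a power of `p^d`; the sign follows from `S(A, 0) ≡ 1 (mod p^d+1)`,
since `x ↦ x^{p^k+1}` has fibres of size divisible by `p^d+1` away from zero
(`goldSum_zero_of_even`). If `n/d` is odd, `x^{p^k+1}` and `x²` have the same value distribution, so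
`S(A, 0)` is the quadratic Gauss sum of `F` times `η(A)` (`goldSum_zero_of_odd`). That Gauss sum is
obtained by diagonalizing the trace form over the prime field, with the class of its discriminant
read off a Moore determinant, and from Gauss's sign theorem for the prime field. -/

noncomputable section

/-! ### Frobenius powers and the linearized polynomial -/

section Frobenius

variable {p : ℕ} [Fact p.Prime] {F : Type*} [Field F]

/-- The linearized polynomial attached to the quadratic form `Tr(A x^{p^k+1})`. -/
def goldLin (p k : ℕ) (A x : F) : F := A ^ p ^ k * x ^ p ^ (2 * k) + A * x

variable {k : ℕ}

theorem goldLin_zero (A : F) : goldLin p k A 0 = 0 := by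
  have : p ≠ 0 := (Fact.out : p.Prime).ne_zero
  simp [goldLin, this]

variable [CharP F p]

theorem pow_bijective_of_char [Finite F] (j : ℕ) : Function.Bijective fun x : F => x ^ p ^ j := by
  rw [← Finite.injective_iff_bijective]
  intro x y h
  exact (iterateFrobenius_inj F p j) (by simpa [iterateFrobenius_def] using h)

theorem goldLin_add (A x y : F) :
    goldLin p k A (x + y) = goldLin p k A x + goldLin p k A y := by
  simp only [goldLin, add_pow_char_pow]; ring

theorem goldLin_neg (A x : F) : goldLin p k A (-x) = -goldLin p k A x := by
  rw [eq_neg_iff_add_eq_zero, ← goldLin_add, neg_add_cancel, goldLin_zero]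

theorem add_pow_gold (x y : F) : (x + y) ^ (p ^ k + 1) =
    x ^ (p ^ k + 1) + (x ^ p ^ k * y + x * y ^ p ^ k) + y ^ (p ^ k + 1) := by
  rw [pow_succ, add_pow_char_pow]; ring

theorem neg_pow_char_pow (y : F) (j : ℕ) : (-y) ^ p ^ j = -y ^ p ^ j := by
  have := add_pow_char_pow (p := p) (n := j) y (-y)
  rw [add_neg_cancel, zero_pow (pow_ne_zero _ (Fact.out : p.Prime).ne_zero)] at this
  linear_combination -this

theorem neg_pow_gold (y : F) : (-y) ^ (p ^ k + 1) = y ^ (p ^ k + 1) := by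
  rw [pow_succ, neg_pow_char_pow, pow_succ]; ring

theorem goldLin_bijective [Finite F] {A : F} (h : ∀ x, goldLin p k A x = 0 → x = 0) :
    Function.Bijective (goldLin p k A) := by
  rw [← Finite.injective_iff_bijective]
  intro x y hxy
  rw [← sub_eq_zero]
  apply h
  rw [sub_eq_add_neg, goldLin_add, goldLin_neg, hxy, add_neg_cancel]

end Frobenius

/-! ### The canonical additive character -/

section TraceCharacter

variable (p : ℕ) [Fact p.Prime] {F : Type*} [Field F] [Fintype F] [Algebra (ZMod p) F]

theorem chiOne_apply (x : F) : chiOne p x = ZMod.stdAddChar (Algebra.trace (ZMod p) F x) := rfl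

theorem chiOne_pow_char (x : F) : chiOne p (x ^ p) = chiOne p x := by
  have h := Algebra.trace_eq_of_algEquiv (FiniteField.frobeniusAlgEquivOfAlgebraic (ZMod p) F) x
  rw [FiniteField.coe_frobeniusAlgEquivOfAlgebraic, ZMod.card] at h
  rw [chiOne_apply, chiOne_apply, h]

theorem chiOne_pow_char_pow (x : F) (j : ℕ) : chiOne p (x ^ p ^ j) = chiOne p x := by
  induction j with
  | zero => simp
  | succ j ih => rw [pow_succ, pow_mul, chiOne_pow_char, ih]

theorem chiOne_isPrimitive : (chiOne p : AddChar F ℂ).IsPrimitive := by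
  apply AddChar.IsPrimitive.of_ne_one
  obtain ⟨x, hx⟩ := Algebra.trace_surjective (ZMod p) F 1
  intro h
  have h1 : chiOne p x = 1 := by rw [h]; rfl
  rw [chiOne_apply, hx] at h1
  have h2 : (ZMod.stdAddChar (1 : ZMod p) : ℂ) = ZMod.stdAddChar (0 : ZMod p) := by simpa using h1
  exact one_ne_zero (ZMod.injective_stdAddChar h2)

open scoped Classical in
theorem sum_chiOne_mul (y : F) :
    ∑ x : F, chiOne p (x * y) = if y = 0 then (Fintype.card F : ℂ) else 0 := by
  rw [AddChar.sum_mulShift y (chiOne_isPrimitive p)]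
  split_ifs <;> simp

theorem conj_chiOne (x : F) : (starRingEnd ℂ) (chiOne p x) = chiOne p (-x) := by
  rw [AddChar.map_neg_eq_conj]

/-- Character values are `p`-th roots of unity and `p` is odd, so squaring loses nothing: with `p =
2m+1`, `z = -m(2z)` in `F`. This is where odd characteristic enters the evaluation on `ker L_A`. -/
theorem chiOne_eq_one_of_two_mul (hp : Odd p) {z : F} (h : chiOne p (2 * z) = 1) :
    chiOne p z = 1 := by
  have : CharP F p := charP_of_injective_algebraMap (algebraMap (ZMod p) F).injective p
  obtain ⟨m, hm⟩ := hp
  have h1 : (m : F) * (2 * z) + z = 0 := by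
    have : ((2 * m + 1 : ℕ) : F) = 0 := by rw [← hm]; exact CharP.cast_eq_zero F p
    push_cast at this
    linear_combination z * this
  have h2 : chiOne p ((m : F) * (2 * z) + z) = 1 := by rw [h1, AddChar.map_zero_eq_one]
  rw [← nsmul_eq_mul, AddChar.map_add_eq_mul, AddChar.map_nsmul_eq_pow, h, one_pow, one_mul] at h2
  exact h2

end TraceCharacter

/-! ### Weil sums of quadratic forms: completing the square, vanishing, absolute value -/

section GoldSum

variable (p k : ℕ) [Fact p.Prime] {F : Type*} [Field F] [Fintype F] [Algebra (ZMod p) F]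

/-- The Weil sum `∑ χ₁(A x^{p^k+1} + B x)`. -/
def goldSum (A B : F) : ℂ := ∑ x : F, chiOne p (A * x ^ (p ^ k + 1) + B * x)

variable {p k}

/-- Raising `A x^{p^k} y` to the power `p^k` preserves its trace. The right side is symmetric in `x`
and `y`, which makes `L_A` self-adjoint for the twisted pairing `(x, y) ↦ Tr(y^{p^k} x)`. -/
theorem chiOne_pow_mul_goldLin [CharP F p] (A x y : F) :
    chiOne p (y ^ p ^ k * goldLin p k A x) = chiOne p (A * (x ^ p ^ k * y + x * y ^ p ^ k)) := by
  have : y ^ p ^ k * goldLin p k A x = (A * x ^ p ^ k * y) ^ p ^ k + A * x * y ^ p ^ k := by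
    rw [goldLin, two_mul, pow_add, pow_mul]; ring
  rw [this, AddChar.map_add_eq_mul, chiOne_pow_char_pow, ← AddChar.map_add_eq_mul]
  congr 1; ring

open scoped Classical in
theorem sum_chiOne_pow_mul [CharP F p] (z : F) :
    ∑ y : F, chiOne p (y ^ p ^ k * z) = if z = 0 then (Fintype.card F : ℂ) else 0 := by
  rw [← sum_chiOne_mul p z]
  exact (pow_bijective_of_char (p := p) (F := F) k).sum_comp fun y => chiOne p (y * z)

theorem goldSum_shift [CharP F p] {A B y : F} :
    goldSum p k A B = chiOne p (A * y ^ (p ^ k + 1) + B * y) *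
      ∑ x : F, chiOne p (A * x ^ (p ^ k + 1)) * chiOne p (x ^ p ^ k * (goldLin p k A y + B ^ p ^ k)) := by
  rw [goldSum, mul_sum, ← Equiv.sum_comp (Equiv.addRight y) fun x => chiOne p (A * x ^ (p ^ k + 1) + B * x)]
  refine sum_congr rfl fun x _ => ?_
  rw [mul_add (x ^ p ^ k), AddChar.map_add_eq_mul _ (x ^ p ^ k * _), chiOne_pow_mul_goldLin,
    ← mul_pow, chiOne_pow_char_pow, ← AddChar.map_add_eq_mul, ← AddChar.map_add_eq_mul,
    ← AddChar.map_add_eq_mul]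
  congr 1
  rw [Equiv.coe_addRight, add_pow_gold]; ring

theorem chiOne_gold_of_goldLin [CharP F p] {A B y : F} (h : goldLin p k A y = B ^ p ^ k) :
    chiOne p (2 * (A * y ^ (p ^ k + 1))) = chiOne p (B * y) := by
  have h1 := chiOne_pow_mul_goldLin (p := p) (k := k) A y y
  rw [h, ← mul_pow, chiOne_pow_char_pow] at h1
  rw [mul_comm B, h1]
  congr 1; ring

/-- Completing the square: translation by `-y` removes the linear term, and the constant left over
simplifies because `B y` and `2 A y^{p^k+1}` have the same character value. -/
theorem goldSum_of_goldLin_eq [CharP F p] {A B y : F} (h : goldLin p k A y = B ^ p ^ k) :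
    goldSum p k A B = chiOne p (-(A * y ^ (p ^ k + 1))) * goldSum p k A 0 := by
  rw [goldSum_shift (y := -y), goldLin_neg, h, neg_pow_gold, neg_add_cancel]
  have h2 : chiOne p (A * y ^ (p ^ k + 1) + B * -y) = chiOne p (-(A * y ^ (p ^ k + 1))) := by
    rw [AddChar.map_add_eq_mul, mul_neg, AddChar.map_neg_eq_inv _ (B * y), ← chiOne_gold_of_goldLin h,
      ← AddChar.map_neg_eq_inv, ← AddChar.map_add_eq_mul]
    congr 1; ring
  rw [h2, goldSum]
  congr 1
  exact sum_congr rfl fun x _ => by simp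

/-- The image of a self-adjoint map is the annihilator of its kernel. A nonzero sum is invariant
under translation by `ker L_A`, which forces `χ₁(B x) = 1` there; then `B^{p^k}` would lie in the
image. -/
theorem goldSum_eq_zero_of_forall_ne [CharP F p] (hp : Odd p) {A B : F} (h : ∀ y, goldLin p k A y ≠ B ^ p ^ k) :
    goldSum p k A B = 0 := by
  classical
  by_contra hS
  have hker : ∀ y, goldLin p k A y = 0 → chiOne p (A * y ^ (p ^ k + 1)+ B * y) = 1 := by
    intro y hy
    have h1 := goldSum_shift (p := p) (k := k) (A := A) (B := B) (y := y)
    have h2 := goldSum_shift (p := p) (k := k) (A := A) (B := B) (y := 0)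
    rw [hy] at h1
    rw [goldLin_zero] at h2
    simp only [mul_zero, add_zero, ne_eq, Nat.add_eq_zero_iff, one_ne_zero, and_false,
      not_false_eq_true, zero_pow, AddChar.map_zero_eq_one, one_mul] at h2
    rw [← h2] at h1
    exact (mul_right_cancel₀ hS ((one_mul _).trans h1)).symm
  -- The double sum detects solutions of `L_A(y) = B^{p^k}`. Summed over `x` first it is zero, there
  -- being none; summed over `y` first it is `q` times a sum over the kernel, which `hone` shows to
  -- be positive.
  have hcount : ∑ x : F, ∑ y : F, chiOne p (x ^ p ^ k * (goldLin p k A y - B ^ p ^ k)) = 0 := by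
    rw [sum_comm]
    refine sum_eq_zero fun y _ => ?_
    rw [sum_chiOne_pow_mul, if_neg (sub_ne_zero.mpr (h y))]
  have hcount2 : ∑ x : F, ∑ y : F, chiOne p (x ^ p ^ k * (goldLin p k A y - B ^ p ^ k)) =
      ∑ x : F, if goldLin p k A x = 0 then (Fintype.card F : ℂ) * chiOne p (-(B * x)) else 0 := by
    refine sum_congr rfl fun x _ => ?_
    have h3 : ∀ y : F, chiOne p (x ^ p ^ k * (goldLin p k A y - B ^ p ^ k)) =
        chiOne p (y ^ p ^ k * goldLin p k A x) * chiOne p (-(B * x)) := by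
      intro y
      rw [mul_sub, sub_eq_add_neg, AddChar.map_add_eq_mul, AddChar.map_neg_eq_inv, ← mul_pow,
        chiOne_pow_char_pow, chiOne_pow_mul_goldLin, chiOne_pow_mul_goldLin,
        AddChar.map_neg_eq_inv, mul_comm x B]
      congr 2; ring
    rw [sum_congr rfl fun y _ => h3 y, ← sum_mul, sum_chiOne_pow_mul]
    split_ifs <;> simp
  have hone : ∀ x, goldLin p k A x = 0 → chiOne p (-(B * x)) = 1 := by
    intro x hx
    have h1 := chiOne_gold_of_goldLin (p := p) (k := k) (A := A) (B := 0) (y := x)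
      (by rw [hx, zero_pow (pow_ne_zero _ (Fact.out : p.Prime).ne_zero)])
    rw [zero_mul, AddChar.map_zero_eq_one] at h1
    have h2 := hker x hx
    rw [AddChar.map_add_eq_mul, chiOne_eq_one_of_two_mul p hp h1, one_mul] at h2
    rw [AddChar.map_neg_eq_inv, h2, inv_one]
  rw [hcount2, ← sum_filter] at hcount
  rw [sum_congr rfl fun x hx => by rw [hone x (mem_filter.mp hx).2, mul_one], sum_const] at hcount
  simp only [nsmul_eq_mul, mul_eq_zero, Nat.cast_eq_zero, card_eq_zero, Fintype.card_ne_zero,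
    or_false, filter_eq_empty_iff, mem_univ, true_implies] at hcount
  exact hcount (goldLin_zero A)

-- Expanding the square and shifting leaves `q ∑ χ₁(A x^{p^k+1})` over `ker L_A`, and each term is
-- `1` because the polar form vanishes on the diagonal there and `p` is odd.
open scoped Classical in
theorem goldSum_mul_conj [CharP F p] (hp : Odd p) (A : F) :
    goldSum p k A 0 * (starRingEnd ℂ) (goldSum p k A 0) =
      Fintype.card F * #{x : F | goldLin p k A x = 0} := by
  have h1 : ∀ y : F, goldSum p k A 0 * chiOne p (-(A * y ^ (p ^ k + 1))) =
      ∑ x : F, chiOne p (A * x ^ (p ^ k + 1)) * chiOne p (y ^ p ^ k * goldLin p k A x) := by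
    intro y
    rw [goldSum_shift (y := y), mul_right_comm, ← AddChar.map_add_eq_mul]
    simp only [zero_mul, add_zero, add_neg_cancel, AddChar.map_zero_eq_one, one_mul,
      zero_pow (pow_ne_zero k (Fact.out : p.Prime).ne_zero)]
    refine sum_congr rfl fun x _ => ?_
    rw [chiOne_pow_mul_goldLin, chiOne_pow_mul_goldLin]
    congr 2; ring
  have h2 : (starRingEnd ℂ) (goldSum p k A 0) = ∑ y : F, chiOne p (-(A * y ^ (p ^ k + 1))) := by
    rw [goldSum, map_sum]
    exact sum_congr rfl fun y _ => by rw [conj_chiOne, zero_mul, add_zero]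
  rw [h2, mul_sum, sum_congr rfl fun y _ => h1 y, sum_comm]
  simp_rw [← mul_sum, sum_chiOne_pow_mul]
  rw [card_filter, Nat.cast_sum, mul_sum]
  refine sum_congr rfl fun x _ => ?_
  split_ifs with hx
  · have h3 := chiOne_gold_of_goldLin (p := p) (k := k) (A := A) (B := 0) (y := x)
      (by rw [hx, zero_pow (pow_ne_zero _ (Fact.out : p.Prime).ne_zero)])
    rw [zero_mul, AddChar.map_zero_eq_one] at h3
    rw [chiOne_eq_one_of_two_mul p hp h3]; simp
  · simp

end GoldSum

/-! ### Fibres of power maps on a finite field -/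

section PowerMap

variable {F : Type*} [Field F] [Fintype F]

open scoped Classical in
theorem card_units_pow_eq {G : Type*} [CommGroup G] [IsCyclic G] [Fintype G] (M : ℕ) (y : G) :
    #{x : G | x ^ M = y} =
      if y ^ (Fintype.card G / (Fintype.card G).gcd M) = 1 then (Fintype.card G).gcd M else 0 := by
  set g := (Fintype.card G).gcd M with hg
  have hgpos : 0 < g := Nat.gcd_pos_of_pos_left _ Fintype.card_pos
  have hgdvd : g ∣ Fintype.card G := Nat.gcd_dvd_left _ _
  -- One inclusion is immediate, and in a cyclic group both subgroups have order `|G| / g`.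
  have hrange : (powMonoidHom M : G →* G).range = (powMonoidHom (Fintype.card G / g)).ker := by
    apply Subgroup.eq_of_le_of_card_ge
    · rintro _ ⟨x, rfl⟩
      obtain ⟨t, ht⟩ : g ∣ M := Nat.gcd_dvd_right _ _
      rw [MonoidHom.mem_ker, powMonoidHom_apply, powMonoidHom_apply, ← pow_mul, ht, mul_right_comm,
        Nat.mul_div_cancel' hgdvd, pow_mul, pow_card_eq_one, one_pow]
    · rw [IsCyclic.card_powMonoidHom_ker, IsCyclic.card_powMonoidHom_range, Nat.card_eq_fintype_card,
        Nat.gcd_eq_right (Nat.div_dvd_of_dvd hgdvd)]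
  split_ifs with hy
  · have hmem : y ∈ (powMonoidHom M : G →* G).range := by
      rw [hrange, MonoidHom.mem_ker]; exact hy
    have h1 := MonoidHom.card_fiber_eq_of_mem_range (powMonoidHom M : G →* G) (x := y) (y := 1)
      hmem ⟨1, map_one _⟩
    have h2 := IsCyclic.card_powMonoidHom_ker (G := G) M
    rw [Nat.card_eq_fintype_card, Nat.card_eq_fintype_card, Fintype.card_subtype] at h2
    simp only [MonoidHom.mem_ker] at h2
    exact (by simpa using h1 : _ = _).trans h2
  · rw [card_eq_zero, filter_eq_empty_iff]
    rintro x - rfl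
    have hmem : x ^ M ∈ (powMonoidHom M : G →* G).range := ⟨x, rfl⟩
    rw [hrange, MonoidHom.mem_ker] at hmem
    exact hy hmem

open scoped Classical in
theorem card_pow_eq {q M : ℕ} (hF : Fintype.card F = q) {y : F} (hy : y ≠ 0) :
    #{x : F | x ≠ 0 ∧ x ^ M = y} =
      if y ^ ((q - 1) / (q - 1).gcd M) = 1 then (q - 1).gcd M else 0 := by
  have h := card_units_pow_eq M (Units.mk0 y hy)
  rw [Fintype.card_units, hF] at h
  have hiff : Units.mk0 y hy ^ ((q - 1) / (q - 1).gcd M) = 1 ↔ y ^ ((q - 1) / (q - 1).gcd M) = 1 := by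
    rw [Units.ext_iff]; simp
  rw [← ite_congr (propext hiff) (fun _ => rfl) (fun _ => rfl), ← h]
  refine (card_nbij (fun x : Fˣ => (x : F)) ?_ ?_ ?_).symm
  · intro x hx
    simp only [coe_filter, mem_univ, true_and, Set.mem_ofPred_eq] at hx ⊢
    exact ⟨x.ne_zero, by rw [← Units.val_pow_eq_pow_val, hx]; rfl⟩
  · intro x _ z _ hxz; exact Units.ext hxz
  · intro x hx
    simp only [coe_filter, mem_univ, true_and, Set.mem_ofPred_eq] at hx
    refine ⟨Units.mk0 x hx.1, ?_, rfl⟩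
    simp only [coe_filter, mem_univ, true_and, Set.mem_ofPred_eq]
    exact Units.ext (by simpa using hx.2)

-- The right side depends on `M` only through `gcd(q-1, M)`. This allows `p^k+1` to be exchanged for
-- `2` when `n/d` is odd, and exposes a divisible factor when `n/d` is even.
open scoped Classical in
theorem sum_pow_eq_sum_card {q M : ℕ} (hF : Fintype.card F = q) (hM : M ≠ 0) (f : F → ℂ) :
    ∑ x, f (x ^ M) = f 0 + (q - 1).gcd M *
      ∑ y ∈ ({0}ᶜ : Finset F) with y ^ ((q - 1) / (q - 1).gcd M) = 1, f y := by
  rw [Fintype.sum_eq_add_sum_compl 0, zero_pow hM]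
  congr 1
  have hmaps : ∀ x ∈ ({0}ᶜ : Finset F), x ^ M ∈ ({0}ᶜ : Finset F) := by
    intro x hx
    simp only [mem_compl, mem_singleton] at hx ⊢
    exact pow_ne_zero M hx
  rw [← sum_fiberwise_of_maps_to hmaps, sum_filter, mul_sum]
  refine sum_congr rfl fun y hy => ?_
  simp only [mem_compl, mem_singleton] at hy
  rw [sum_congr rfl fun x hx => by rw [(mem_filter.mp hx).2], sum_const]
  have h := card_pow_eq (M := M) hF hy
  have hset : ({x ∈ ({0}ᶜ : Finset F) | x ^ M = y}) = ({x : F | x ≠ 0 ∧ x ^ M = y} : Finset F) := by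
    ext x; simp
  rw [hset, h]
  split_ifs <;> simp

theorem exists_pow_eq {q M : ℕ} (hF : Fintype.card F = q) {y : F} (hy : y ≠ 0)
    (h : y ^ ((q - 1) / (q - 1).gcd M) = 1) : ∃ x : F, x ^ M = y := by
  classical
  have hc := card_pow_eq (M := M) hF hy
  rw [if_pos h] at hc
  have hq : 0 < q - 1 := by
    have := Fintype.one_lt_card (α := F)
    omega
  have hpos : 0 < #{x : F | x ≠ 0 ∧ x ^ M = y} := hc ▸ Nat.gcd_pos_of_pos_left _ hq
  obtain ⟨x, hx⟩ := card_pos.mp hpos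
  exact ⟨x, (mem_filter.mp hx).2.2⟩

end PowerMap

/-! ### Parity and greatest common divisors of exponents -/

section Parity

theorem odd_pow_sub_one_div {Q r : ℕ} (hQ : Odd Q) (hQ1 : 2 ≤ Q) :
    Odd ((Q ^ r - 1) / (Q - 1)) ↔ Odd r := by
  rw [← Nat.geomSum_eq hQ1]
  induction r with
  | zero => simp
  | succ r ih =>
    rw [sum_range_succ, Nat.odd_add, ih, Nat.odd_add]
    have : Odd (Q ^ r) := hQ.pow
    have h1 : ¬ Even (Q ^ r) := Nat.not_even_iff_odd.mpr this
    have h2 : ¬ Even 1 := by decide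
    tauto

/-- For odd `Q`, `Q² - 1 = (Q-1)(Q+1)` is divisible by `2(Q+1)`. The extra factor `2` in the modulus
makes the quotient `(Q^s+1)/(Q+1)` odd. -/
theorem pow_add_one_modEq {Q s : ℕ} (hQ : Odd Q) (hs : Odd s) :
    Q ^ s + 1 ≡ Q + 1 [MOD 2 * (Q + 1)] := by
  obtain ⟨t, rfl⟩ := hs
  have h2 : Q ^ 2 ≡ 1 [MOD 2 * (Q + 1)] := by
    obtain ⟨j, rfl⟩ := hQ
    apply Nat.ModEq.symm
    rw [Nat.modEq_iff_dvd]
    exact ⟨j, by push_cast; ring⟩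
  have : Q ^ (2 * t + 1) ≡ Q [MOD 2 * (Q + 1)] := by
    rw [pow_succ, pow_mul]
    simpa using (h2.pow t).mul_right Q
  exact this.add_right 1

theorem exists_pow_add_one_eq {Q s : ℕ} (hQ : Odd Q) (hs : Odd s) :
    ∃ t, Odd t ∧ Q ^ s + 1 = (Q + 1) * t := by
  have h := pow_add_one_modEq hQ hs
  have hle : Q + 1 ≤ Q ^ s + 1 := by
    have : Q ≤ Q ^ s := Nat.le_self_pow (by rintro rfl; simp at hs) Q
    omega
  obtain ⟨j, hj⟩ := (Nat.modEq_iff_dvd' hle).mp h.symm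
  refine ⟨2 * j + 1, ⟨j, rfl⟩, ?_⟩
  have : Q ^ s + 1 = (Q + 1) + 2 * (Q + 1) * j := by omega
  rw [this]; ring

theorem gcd_two_mul_of_even {n k : ℕ} (h : Even (n / n.gcd k)) (hn : n ≠ 0) :
    n.gcd (2 * k) = 2 * n.gcd k ∧ Odd (k / n.gcd k) := by
  obtain ⟨d, n', k', hd, hco, rfl, rfl⟩ := Nat.exists_coprime' (m := n) (n := k)
    (Nat.gcd_pos_of_pos_left _ (Nat.pos_of_ne_zero hn))
  rw [Nat.gcd_mul_right, hco.gcd_eq_one, one_mul] at *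
  rw [Nat.mul_div_cancel _ hd] at *
  have hk : Odd k' := by
    by_contra hk
    have := Nat.dvd_gcd h.two_dvd (Nat.not_odd_iff_even.mp hk).two_dvd
    rw [hco.gcd_eq_one] at this
    omega
  refine ⟨?_, hk⟩
  rw [← mul_assoc, Nat.gcd_mul_right, Nat.Coprime.gcd_mul_right_cancel_right 2 hco.symm, Nat.gcd_eq_right h.two_dvd]

theorem gcd_two_mul_of_odd {n k : ℕ} (h : Odd (n / n.gcd k)) : n.gcd (2 * k) = n.gcd k := by
  have hn : n ≠ 0 := by rintro rfl; simp at h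
  obtain ⟨d, n', k', hd, hco, rfl, rfl⟩ := Nat.exists_coprime' (m := n) (n := k)
    (Nat.gcd_pos_of_pos_left _ (Nat.pos_of_ne_zero hn))
  rw [Nat.gcd_mul_right, hco.gcd_eq_one, one_mul] at *
  rw [Nat.mul_div_cancel _ hd] at *
  have h2 : n'.gcd 2 = 1 := Nat.coprime_two_right.mpr h
  rw [← mul_assoc, Nat.gcd_mul_right, Nat.Coprime.gcd_mul_right_cancel_right 2 hco.symm, h2, one_mul]

end Parity

/-! ### The kernel of the linearized polynomial -/

section Kernel

variable {p n k : ℕ} [Fact p.Prime] {F : Type*} [Field F]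

theorem goldLin_eq_zero_iff {A x : F} (hA : A ≠ 0) (hx : x ≠ 0) :
    goldLin p k A x = 0 ↔ x ^ (p ^ (2 * k) - 1) = -(A⁻¹) ^ (p ^ k - 1) := by
  have hp : 0 < p := (Fact.out : p.Prime).pos
  have h1 : x ^ p ^ (2 * k) = x ^ (p ^ (2 * k) - 1) * x := by
    rw [← pow_succ, Nat.sub_add_cancel (Nat.pow_pos hp)]
  have h2 : A ^ p ^ k = A ^ (p ^ k - 1) * A := by
    rw [← pow_succ, Nat.sub_add_cancel (Nat.pow_pos hp)]
  have hA' : A ^ (p ^ k - 1) ≠ 0 := pow_ne_zero _ hA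
  have h3 : goldLin p k A x = (x * A) * (A ^ (p ^ k - 1) * x ^ (p ^ (2 * k) - 1) + 1) := by
    rw [goldLin, h1, h2]; ring
  rw [h3, mul_eq_zero, or_iff_right (mul_ne_zero hx hA), inv_pow]
  constructor
  · intro h
    field_simp
    linear_combination h
  · intro h
    rw [h]; field_simp; ring

variable [Fintype F]

-- Nonzero kernel elements are roots of `x^{p^{2k}-1} = -A^{1-p^k}`. Since `gcd(p^n-1, p^{2k}-1) =
-- p^e-1`, there are `p^e-1` of them or none, by the power-residue criterion.
open scoped Classical in
theorem card_goldLin_ker (hp : Odd p) (hn : n ≠ 0) (hF : Fintype.card F = p ^ n) {A : F}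
    (hA : A ≠ 0) :
    #{x : F | goldLin p k A x = 0} =
      if A ^ ((p ^ k - 1) * ((p ^ n - 1) / (p ^ n.gcd (2 * k) - 1))) = (-1) ^ (n / n.gcd (2 * k))
      then p ^ n.gcd (2 * k) else 1 := by
  set e := n.gcd (2 * k) with he
  have hepos : 0 < e := Nat.gcd_pos_of_pos_left _ (Nat.pos_of_ne_zero hn)
  have hp1 : 1 < p := (Fact.out : p.Prime).one_lt
  have hQ : 2 ≤ p ^ e := Nat.one_lt_pow hepos.ne' hp1
  have hgcd : (p ^ n - 1).gcd (p ^ (2 * k) - 1) = p ^ e - 1 := Nat.pow_sub_one_gcd_pow_sub_one _ _ _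
  have hsplit : ({x : F | goldLin p k A x = 0} : Finset F) =
      insert 0 ({x : F | x ≠ 0 ∧ x ^ (p ^ (2 * k) - 1) = -(A⁻¹) ^ (p ^ k - 1)} : Finset F) := by
    ext x
    by_cases hx : x = 0
    · simp [hx, goldLin_zero]
    · simp [hx, goldLin_eq_zero_iff hA hx]
  have hne : -(A⁻¹) ^ (p ^ k - 1) ≠ 0 := neg_ne_zero.mpr (pow_ne_zero _ (inv_ne_zero hA))
  rw [hsplit, card_insert_of_notMem (by simp), card_pow_eq hF hne, hgcd]
  -- `(p^n-1)/(p^e-1)` is a sum of `n/e` odd terms, so it has the parity of `n/e`.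
  have hpar : (-1 : F) ^ ((p ^ n - 1) / (p ^ e - 1)) = (-1) ^ (n / e) := by
    apply neg_one_pow_congr
    have h1 : p ^ n = (p ^ e) ^ (n / e) := by
      rw [← pow_mul, Nat.mul_div_cancel' (Nat.gcd_dvd_left _ _)]
    rw [h1, ← not_iff_not, Nat.not_even_iff_odd, Nat.not_even_iff_odd]
    exact odd_pow_sub_one_div hp.pow hQ
  have hiff : (-(A⁻¹) ^ (p ^ k - 1)) ^ ((p ^ n - 1) / (p ^ e - 1)) = 1 ↔
      A ^ ((p ^ k - 1) * ((p ^ n - 1) / (p ^ e - 1))) = (-1) ^ (n / e) := by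
    rw [neg_pow, hpar, ← pow_mul, inv_pow, ← div_eq_mul_inv, div_eq_one_iff_eq, eq_comm]
    exact pow_ne_zero _ hA
  simp only [hiff]
  split_ifs <;> omega

end Kernel

/-! ### Evaluation of the pure Gold sum for `n/d` even -/

section EvenCase

variable {p n k : ℕ} [Fact p.Prime] {F : Type*} [Field F] [Fintype F]

theorem pow_odd_power_eq {M : Type*} [Monoid M] {w : M} {Q s : ℕ} (hw : w ^ Q ^ 2 = w)
    (hs : Odd s) : w ^ Q ^ s = w ^ Q := by
  obtain ⟨t, rfl⟩ := hs
  induction t with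
  | zero => simp
  | succ t ih =>
    rw [show 2 * (t + 1) + 1 = 2 + (2 * t + 1) by ring, pow_add, pow_mul, hw, ih]

/-- Here `e = 2d` and `A^{(p^n-1)/(p^{2d}-1)}` lies in the subfield of order `p^{2d}`. As `k/d` is
odd, the `p^k`-th and `p^d`-th powers agree on that subfield. -/
theorem kernel_condition_iff_of_even (hn : n ≠ 0)
    (hF : Fintype.card F = p ^ n) (heven : Even (n / n.gcd k)) {A : F} (hA : A ≠ 0) :
    A ^ ((p ^ k - 1) * ((p ^ n - 1) / (p ^ n.gcd (2 * k) - 1))) = (-1) ^ (n / n.gcd (2 * k)) ↔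
      A ^ ((p ^ n - 1) / (p ^ n.gcd k + 1)) = (-1) ^ (n / (2 * n.gcd k)) := by
  obtain ⟨he, hs⟩ := gcd_two_mul_of_even heven hn
  set d := n.gcd k with hd
  have hdpos : 0 < d := Nat.gcd_pos_of_pos_left _ (Nat.pos_of_ne_zero hn)
  have hp1 : 1 < p := (Fact.out : p.Prime).one_lt
  have hQ : 1 < p ^ d := Nat.one_lt_pow hdpos.ne' hp1
  have h2d : 2 * d ∣ n := he ▸ Nat.gcd_dvd_left _ _
  have hsq : p ^ (2 * d) - 1 = (p ^ d + 1) * (p ^ d - 1) := by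
    rw [mul_comm 2, pow_mul, ← Nat.sq_sub_sq, one_pow]
  obtain ⟨N, hN⟩ : (p ^ (2 * d) - 1) ∣ p ^ n - 1 := Nat.pow_sub_one_dvd_pow_sub_one p h2d
  have hpos : 0 < p ^ d - 1 := by omega
  have hpos2 : 0 < p ^ (2 * d) - 1 := by rw [hsq]; positivity
  rw [he, hN, Nat.mul_div_cancel_left _ hpos2, hsq, mul_assoc, Nat.mul_div_cancel_left _ (by omega),
    mul_comm, pow_mul, mul_comm (p ^ d - 1), pow_mul A]
  set w := A ^ N with hw
  have hw0 : w ≠ 0 := pow_ne_zero _ hA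
  have hw1 : w ^ (p ^ d) ^ 2 = w := by
    have h1 : w ^ (p ^ (2 * d) - 1) = 1 := by
      rw [hw, ← pow_mul, mul_comm, ← hN, ← hF]; exact FiniteField.pow_card_sub_one_eq_one A hA
    rw [← pow_mul p, mul_comm d, ← Nat.sub_add_cancel (Nat.pow_pos hp1.le : 0 < p ^ (2 * d)), pow_succ,
      h1, one_mul]
  have hk : p ^ k = (p ^ d) ^ (k / d) := by
    rw [← pow_mul, Nat.mul_div_cancel' (Nat.gcd_dvd_right _ _)]
  have h2 : w ^ (p ^ k - 1) = w ^ (p ^ d - 1) := by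
    apply mul_right_cancel₀ hw0
    rw [← pow_succ, ← pow_succ, Nat.sub_add_cancel (Nat.pow_pos hp1.le), Nat.sub_add_cancel hQ.le, hk]
    exact pow_odd_power_eq hw1 hs
  rw [h2]

variable [Algebra (ZMod p) F]

theorem isIntegral_chiOne (x : F) : IsIntegral ℤ (chiOne p x) := by
  refine IsIntegral.of_pow (n := p) (Fact.out : p.Prime).pos ?_
  have : CharP F p := charP_of_injective_algebraMap (algebraMap (ZMod p) F).injective p
  rw [← AddChar.map_nsmul_eq_pow, nsmul_eq_mul, CharP.cast_eq_zero, zero_mul,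
    AddChar.map_zero_eq_one]
  exact isIntegral_one

theorem int_dvd_of_isIntegral {a b : ℤ} {z : ℂ} (hz : IsIntegral ℤ z) (h : (a : ℂ) = b * z) :
    b ∣ a := by
  by_cases hb : b = 0
  · subst hb
    have : (a : ℂ) = 0 := by simpa using h
    have h0 : a = 0 := by exact_mod_cast this
    rw [h0]
  have hz' : z = algebraMap ℚ ℂ ((a : ℚ) / b) := by
    have : (b : ℂ) ≠ 0 := by exact_mod_cast hb
    rw [eq_ratCast]; push_cast
    rw [h, mul_div_cancel_left₀ _ this]
  rw [hz', isIntegral_algebraMap_iff (algebraMap ℚ ℂ).injective] at hz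
  obtain ⟨y, hy⟩ := IsIntegrallyClosed.isIntegral_iff.mp hz
  refine ⟨y, ?_⟩
  have hb' : (b : ℚ) ≠ 0 := by exact_mod_cast hb
  rw [eq_div_iff hb'] at hy
  have : (y : ℚ) * b = a := by simpa using hy
  have h2 : y * b = a := by exact_mod_cast this
  rw [← h2]; ring

/-- An integer-valued Gold sum is `1` modulo `p^d + 1`. -/
theorem dvd_sub_one_of_goldSum_eq (hF : Fintype.card F = p ^ n) {D : ℕ} (hD : D ∣ p ^ n - 1)
    (hD' : D ∣ p ^ k + 1) {A : F} {a : ℤ} (h : goldSum p k A 0 = a) : (D : ℤ) ∣ a - 1 := by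
  classical
  -- `x = 0` contributes `1`; the rest is `gcd(q-1, p^k+1) = D j` times an algebraic integer.
  obtain ⟨j, hj⟩ := Nat.dvd_gcd hD hD'
  have h1 := sum_pow_eq_sum_card hF (M := p ^ k + 1) (by omega) fun x => chiOne p (A * x)
  have h2 : goldSum p k A 0 = ∑ x : F, chiOne p (A * x ^ (p ^ k + 1)) := by simp [goldSum]
  rw [← h2, h, hj, mul_zero, AddChar.map_zero_eq_one] at h1
  set T : ℂ := ∑ y ∈ ({0}ᶜ : Finset F) with y ^ ((p ^ n - 1) / (D * j)) = 1, chiOne p (A * y) with hT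
  have hTint : IsIntegral ℤ ((j : ℂ) * T) :=
    (isIntegral_algebraMap (R := ℤ) (x := (j : ℤ))).mul (IsIntegral.sum _ fun y _ => isIntegral_chiOne _)
  refine int_dvd_of_isIntegral (z := (j : ℂ) * T) (by simpa using hTint) ?_
  push_cast at h1 ⊢
  linear_combination h1

/-- Substituting `x ↦ w x` with `w^{p^k+1} = -1` turns the sum into its conjugate. Such a `w` is
found for `p^d+1` first; it serves for `k` because `(p^k+1)/(p^d+1)` is odd. -/
theorem conj_goldSum_of_even (hp : Odd p) (hn : n ≠ 0) (hF : Fintype.card F = p ^ n)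
    (heven : Even (n / n.gcd k)) (A : F) :
    (starRingEnd ℂ) (goldSum p k A 0) = goldSum p k A 0 := by
  obtain ⟨he, hs⟩ := gcd_two_mul_of_even heven hn
  set d := n.gcd k with hd
  have hdpos : 0 < d := Nat.gcd_pos_of_pos_left _ (Nat.pos_of_ne_zero hn)
  have hp1 : 1 < p := (Fact.out : p.Prime).one_lt
  have hQ : 1 < p ^ d := Nat.one_lt_pow hdpos.ne' hp1
  have h2d : 2 * d ∣ n := he ▸ Nat.gcd_dvd_left _ _
  have hsq : p ^ (2 * d) - 1 = (p ^ d + 1) * (p ^ d - 1) := by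
    rw [mul_comm 2, pow_mul, ← Nat.sq_sub_sq, one_pow]
  obtain ⟨N, hN⟩ : (p ^ (2 * d) - 1) ∣ p ^ n - 1 := Nat.pow_sub_one_dvd_pow_sub_one p h2d
  have hdvd : p ^ d + 1 ∣ p ^ n - 1 := ⟨(p ^ d - 1) * N, by rw [hN, hsq, mul_assoc]⟩
  obtain ⟨w, hw⟩ : ∃ w : F, w ^ (p ^ d + 1) = -1 := by
    refine exists_pow_eq hF (neg_ne_zero.mpr one_ne_zero) ?_
    rw [Nat.gcd_eq_right hdvd, hN, hsq, mul_assoc, Nat.mul_div_cancel_left _ (by omega)]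
    have : Even (p ^ d - 1) := (hp.pow.tsub_odd odd_one)
    exact (this.mul_right N).neg_one_pow
  have hw0 : w ≠ 0 := by
    rintro rfl
    rw [zero_pow (by omega)] at hw
    exact one_ne_zero (neg_eq_zero.mp hw.symm)
  obtain ⟨t, ht, htk⟩ := exists_pow_add_one_eq (hp.pow (n := d)) hs
  rw [← pow_mul, Nat.mul_div_cancel' (Nat.gcd_dvd_right _ _)] at htk
  have hwk : w ^ (p ^ k + 1) = -1 := by rw [htk, pow_mul, hw, ht.neg_one_pow]
  rw [goldSum, map_sum, ← Equiv.sum_comp (Equiv.mulLeft₀ w hw0) fun x =>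
    chiOne p (A * x ^ (p ^ k + 1) + 0 * x)]
  refine sum_congr rfl fun x _ => ?_
  rw [conj_chiOne, Equiv.mulLeft₀_apply, mul_pow, hwk]
  congr 1; ring

/-- Since `D ≡ -1 (mod D+1)`, the hypothesis says `s (-1)^r ≡ 1`, and a modulus above `2` separates
the two signs. -/
theorem int_dvd_sign_sub_one {D r : ℕ} {s : ℤ} (hD : 2 < D + 1) (hs : s = 1 ∨ s = -1)
    (h : ((D + 1 : ℕ) : ℤ) ∣ s * D ^ r - 1) : s = (-1) ^ r := by
  have h1 : ((D + 1 : ℕ) : ℤ) ∣ (D : ℤ) ^ r - (-1) ^ r := by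
    have := sub_dvd_pow_sub_pow (D : ℤ) (-1) r
    simpa using this
  have h2 : ((D + 1 : ℕ) : ℤ) ∣ s * (-1) ^ r - 1 := by
    have := dvd_sub h (h1.mul_left s)
    have e : s * (D : ℤ) ^ r - 1 - s * ((D : ℤ) ^ r - (-1) ^ r) = s * (-1) ^ r - 1 := by ring
    rwa [e] at this
  have hno : ¬ ((D + 1 : ℕ) : ℤ) ∣ -2 := by
    rw [dvd_neg]
    intro h3
    have := Int.le_of_dvd (by norm_num) h3
    push_cast at this
    omega
  rcases hs with rfl | rfl <;> rcases neg_one_pow_eq_or ℤ r with hr | hr <;> rw [hr] at h2 ⊢ <;>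
    simp at h2 hno ⊢ <;> exact hno h2

theorem goldSum_zero_of_even (hp : Odd p) (hn : n ≠ 0) (hF : Fintype.card F = p ^ n)
    (heven : Even (n / n.gcd k)) {m : ℕ} (hm : n = 2 * m) {A : F} (hA : A ≠ 0)
    [Decidable (A ^ ((p ^ n - 1) / (p ^ n.gcd k + 1)) = (-1) ^ (n / (2 * n.gcd k)))] :
    goldSum p k A 0 =
      if A ^ ((p ^ n - 1) / (p ^ n.gcd k + 1)) = (-1) ^ (n / (2 * n.gcd k))
      then (-1) ^ (m / n.gcd k + 1) * (p : ℂ) ^ (m + n.gcd k)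
      else (-1) ^ (m / n.gcd k) * (p : ℂ) ^ m := by
  classical
  have : CharP F p := charP_of_injective_algebraMap (algebraMap (ZMod p) F).injective p
  obtain ⟨he, hs⟩ := gcd_two_mul_of_even heven hn
  have hnorm := goldSum_mul_conj (p := p) (k := k) hp A
  rw [conj_goldSum_of_even hp hn hF heven, card_goldLin_ker hp hn hF hA,
    if_congr (kernel_condition_iff_of_even hn hF heven hA) rfl rfl, he, hF] at hnorm
  set d := n.gcd k with hd
  have hdpos : 0 < d := Nat.gcd_pos_of_pos_left _ (Nat.pos_of_ne_zero hn)
  have hp1 : 1 < p := (Fact.out : p.Prime).one_lt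
  have hQ : 1 < p ^ d := Nat.one_lt_pow hdpos.ne' hp1
  have h2d : 2 * d ∣ n := he ▸ Nat.gcd_dvd_left _ _
  have hdm : d ∣ m := Nat.dvd_of_mul_dvd_mul_left two_pos (hm ▸ h2d)
  have hsq : p ^ (2 * d) - 1 = (p ^ d + 1) * (p ^ d - 1) := by
    rw [mul_comm 2, pow_mul, ← Nat.sq_sub_sq, one_pow]
  have hD : p ^ d + 1 ∣ p ^ n - 1 :=
    (Dvd.intro _ hsq.symm).trans (Nat.pow_sub_one_dvd_pow_sub_one p h2d)
  obtain ⟨t, ht, htk⟩ := exists_pow_add_one_eq (hp.pow (n := d)) hs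
  rw [← pow_mul, Nat.mul_div_cancel' (Nat.gcd_dvd_right _ _)] at htk
  -- Used with `r = m/d` for trivial kernel and `r = m/d + 1` when the kernel has `p^{2d}` elements.
  have key : ∀ r : ℕ, goldSum p k A 0 * goldSum p k A 0 = ((p ^ d : ℕ) : ℂ) ^ r * ((p ^ d : ℕ) : ℂ) ^ r →
      goldSum p k A 0 = (-1) ^ r * ((p ^ d : ℕ) : ℂ) ^ r := by
    intro r h
    have : ∃ s : ℤ, (s = 1 ∨ s = -1) ∧ goldSum p k A 0 = ((s * ((p ^ d : ℕ) : ℤ) ^ r : ℤ) : ℂ) := by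
      rcases mul_self_eq_mul_self_iff.mp h with h | h
      · exact ⟨1, Or.inl rfl, by rw [h]; push_cast; ring⟩
      · exact ⟨-1, Or.inr rfl, by rw [h]; push_cast; ring⟩
    obtain ⟨s, hs1, hs2⟩ := this
    have := dvd_sub_one_of_goldSum_eq hF hD ⟨t, htk⟩ hs2
    have := int_dvd_sign_sub_one (by omega) hs1 this
    rw [hs2, this]; push_cast; ring
  have hpm : (p : ℂ) ^ m = ((p ^ d : ℕ) : ℂ) ^ (m / d) := by
    push_cast; rw [← pow_mul, Nat.mul_div_cancel' hdm]
  split_ifs with hc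
  · rw [if_pos hc] at hnorm
    rw [key (m / d + 1), pow_add (p : ℂ), hpm]
    · push_cast; ring
    · have hn2 : (p : ℂ) ^ n = (p : ℂ) ^ m * (p : ℂ) ^ m := by rw [hm]; ring
      rw [hnorm, pow_succ, ← hpm]; push_cast; rw [hn2]; ring
  · rw [if_neg hc] at hnorm
    rw [key (m / d), hpm]
    rw [hnorm, hm, ← hpm]; push_cast; ring

end EvenCase

/-! ### The sign of the quadratic Gauss sum over the prime field -/

section GaussSumSign

open Polynomial

/-- This is `∏ (1 - ζ^{2j}) = p` with the factors for `j` and `p - j` paired. -/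
theorem prod_sq_eq {p h : ℕ} (hh : p = 2 * h + 1) {ζ : ℂ} (hζ : IsPrimitiveRoot ζ p) :
    (∏ r ∈ range h, (ζ ^ (r + 1) - ζ ^ (p - (r + 1)))) ^ 2 = (-1) ^ h * p := by
  have hco : Nat.Coprime 2 p := by rw [hh]; simp
  have h2 : IsPrimitiveRoot (ζ ^ 2) (2 * h + 1) := hh ▸ hζ.pow_of_coprime 2 hco
  have hprod := h2.prod_one_sub_pow_eq_order
  rw [two_mul, prod_range_add, ← prod_range_reflect (fun x => 1 - (ζ ^ 2) ^ (h + x + 1)),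
    ← prod_mul_distrib] at hprod
  have hc : (p : ℂ) = ((h + h : ℕ) : ℂ) + 1 := by rw [hh]; push_cast; ring
  have hm : (-1 : ℂ) ^ h = ∏ _r ∈ range h, (-1) := by rw [prod_const, card_range]
  rw [hc, ← hprod, ← prod_pow, hm, ← prod_mul_distrib]
  refine prod_congr rfl fun r hr => ?_
  have hr' := mem_range.mp hr
  have hz : ζ ^ (r + 1) * ζ ^ (p - (r + 1)) = 1 := by
    rw [← pow_add, Nat.add_sub_cancel' (by omega), hζ.pow_eq_one]
  have e1 : h + (h - 1 - r) + 1 = p - (r + 1) := by omega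
  rw [e1, ← pow_mul, ← pow_mul, mul_comm 2, mul_comm 2, pow_mul, pow_mul ζ]
  linear_combination (ζ ^ (r + 1) * ζ ^ (p - (r + 1)) - 1) * hz

variable (p : ℕ) [Fact p.Prime]

/-- The Euler derivation `X d/dX`. -/
def eulerDeriv {R : Type*} [CommRing R] (f : R[X]) : R[X] := X * derivative f

theorem iterate_eulerDeriv_geom {R : Type*} [CommRing R] (N i : ℕ) :
    eulerDeriv^[i] (∑ j ∈ range N, (X : R[X]) ^ j) =
      ∑ j ∈ range N, C ((j : R) ^ i) * X ^ j := by
  induction i with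
  | zero => simp
  | succ i ih =>
    rw [Function.iterate_succ_apply', ih, eulerDeriv, derivative_sum, mul_sum]
    refine sum_congr rfl fun j _ => ?_
    rw [derivative_C_mul_X_pow]
    rcases j with _ | j
    · simp
    · simp only [Nat.add_sub_cancel, pow_succ, map_mul]; ring

/-- Each Euler derivative lowers the order of vanishing at `1` by one; the leading factors `p-1,
p-2, …` are `-1, -2, …` modulo `p`. -/
theorem iterate_eulerDeriv_X_sub_one_pow (i : ℕ) (hi : i ≤ p - 1) :
    ∃ u : (ZMod p)[X], eulerDeriv^[i] ((X - 1 : (ZMod p)[X]) ^ (p - 1)) =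
      (X - 1) ^ (p - 1 - i) * u ∧ u.eval 1 = (-1) ^ i * (i.factorial : ZMod p) := by
  induction i with
  | zero => exact ⟨1, by simp, by simp⟩
  | succ i ih =>
    obtain ⟨u, hu, hu1⟩ := ih (by omega)
    obtain ⟨a, ha⟩ : ∃ a, p - 1 - i = a + 1 := ⟨p - 1 - i - 1, by omega⟩
    have ha' : p - 1 - (i + 1) = a := by omega
    have hap : ((a : ZMod p) + 1) = -(i + 1) := by
      have h : ((a + 1 + (i + 1) : ℕ) : ZMod p) = 0 := by
        rw [show a + 1 + (i + 1) = p by have := (Fact.out : p.Prime).one_lt; omega]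
        exact CharP.cast_eq_zero _ p
      push_cast at h
      linear_combination h
    refine ⟨X * ((a + 1 : (ZMod p)[X]) * u + (X - 1) * derivative u), ?_, ?_⟩
    · rw [Function.iterate_succ_apply', hu, ha, ha', eulerDeriv, derivative_mul, derivative_pow]
      simp
      ring
    · simp [hu1, Nat.factorial_succ, pow_succ, hap]
      ring

theorem X_pow_sub_X_pow_eq {R : Type*} [CommRing R] (a b : ℕ) :
    ∃ v : R[X], X ^ a - X ^ (a + b) = (X - 1) * v ∧ v.eval 1 = -(b : R) := by
  refine ⟨-(X ^ a * ∑ i ∈ range b, X ^ i), ?_, by simp [eval_finsetSum]⟩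
  have := geom_sum_mul (X : R[X]) b
  rw [pow_add]
  linear_combination (X : R[X]) ^ a * this

/-- A relation at `ζ` becomes divisibility by `Φ_p ≡ (X-1)^{p-1}` modulo `p`. By Euler's criterion
the character sum is there the `h`-fold Euler derivative of `Φ_p`, so both sides vanish to order `h`
at `1`; comparing leading coefficients gives `(-1)^h h! = ε 2^h h!`. -/
theorem sign_congruence {h : ℕ} (hh : p = 2 * h + 1) {ζ : ℂ} (hζ : IsPrimitiveRoot ζ p) (ε : ℤ)
    (heq : ∑ j ∈ range p, ((quadraticChar (ZMod p) j : ℤ) : ℂ) * ζ ^ j =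
      ε * ∏ r ∈ range h, (ζ ^ (r + 1) - ζ ^ (p - (r + 1)))) :
    (ε : ZMod p) * 2 ^ h = (-1) ^ h := by
  have hpp : p.Prime := Fact.out
  have hp1 : 1 < p := hpp.one_lt
  have hpos : 0 < h := by omega
  set f : ℤ[X] := ∑ j ∈ range p, C (quadraticChar (ZMod p) j) * X ^ j -
    C ε * ∏ r ∈ range h, (X ^ (r + 1) - X ^ (p - (r + 1))) with hf
  have hroot : aeval ζ f = 0 := by
    simpa [hf, sub_eq_zero] using heq
  have hdvd : cyclotomic p ℤ ∣ f := by
    rw [cyclotomic_eq_minpoly hζ hpp.pos]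
    exact minpoly.isIntegrallyClosed_dvd (hζ.isIntegral hpp.pos) hroot
  have hdvd' := Polynomial.map_dvd (Int.castRingHom (ZMod p)) hdvd
  have hcyc : cyclotomic p (ZMod p) = (X - 1) ^ (p - 1) := by
    have h1 := cyclotomic_prime_mul_X_sub_one (ZMod p) p
    have hne : (X - 1 : (ZMod p)[X]) ≠ 0 := X_sub_C_ne_zero 1
    apply mul_right_cancel₀ hne
    rw [h1, ← pow_succ, Nat.sub_add_cancel hp1.le, sub_pow_char, one_pow]
  rw [map_cyclotomic, hcyc] at hdvd'
  have hchar : ringChar (ZMod p) ≠ 2 := by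
    rw [ZMod.ringChar_zmod_n]; omega
  have hS : ∑ j ∈ range p, C (((quadraticChar (ZMod p) j : ℤ) : ZMod p)) * X ^ j =
      eulerDeriv^[h] ((X - 1 : (ZMod p)[X]) ^ (p - 1)) := by
    rw [← hcyc, cyclotomic_prime, iterate_eulerDeriv_geom]
    refine sum_congr rfl fun j _ => ?_
    rw [quadraticChar_eq_pow_of_char_ne_two' hchar, ZMod.card, show p / 2 = h by omega]
  obtain ⟨u, hu, hu1⟩ := iterate_eulerDeriv_X_sub_one_pow p h (by omega)
  have hv : ∀ r ∈ range h, ∃ v : (ZMod p)[X], X ^ (r + 1) - X ^ (p - (r + 1)) = (X - 1) * v ∧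
      v.eval 1 = 2 * ((r + 1 : ℕ) : ZMod p) := by
    intro r hr
    have hr' := mem_range.mp hr
    obtain ⟨v, hv, hv1⟩ := X_pow_sub_X_pow_eq (R := ZMod p) (r + 1) (p - 2 * (r + 1))
    refine ⟨v, by rw [← hv, show p - (r + 1) = r + 1 + (p - 2 * (r + 1)) by omega], ?_⟩
    rw [hv1, Nat.cast_sub (by omega), CharP.cast_eq_zero]
    push_cast; ring
  choose! v hv hv1 using hv
  have hmap : f.map (Int.castRingHom (ZMod p)) =
      (X - 1) ^ h * (u - C (ε : ZMod p) * ∏ r ∈ range h, v r) := by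
    have hprod : ∏ r ∈ range h, (X ^ (r + 1) - X ^ (p - (r + 1)) : (ZMod p)[X]) =
        (X - 1) ^ h * ∏ r ∈ range h, v r := by
      rw [prod_congr rfl hv, prod_mul_distrib, prod_const, card_range]
    rw [show p - 1 - h = h by omega] at hu
    rw [mul_sub, ← hu, ← hS, mul_left_comm, ← hprod, hf]
    simp [Polynomial.map_sum, Polynomial.map_prod]
  rw [hmap, show p - 1 = h + h by omega, pow_add] at hdvd'
  have hd2 := (mul_dvd_mul_iff_left (pow_ne_zero h (X_sub_C_ne_zero (1 : ZMod p)))).mp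
    (by simpa using hdvd')
  have hd3 : (X - C 1 : (ZMod p)[X]) ∣ u - C (ε : ZMod p) * ∏ r ∈ range h, v r :=
    (dvd_pow_self _ hpos.ne').trans (by simpa using hd2)
  rw [dvd_iff_isRoot, IsRoot, eval_sub, eval_mul, eval_C, eval_prod, prod_congr rfl hv1,
    prod_mul_distrib, prod_const, card_range, hu1, ← Nat.cast_prod, prod_range_add_one_eq_factorial]
    at hd3
  have hfac : (h.factorial : ZMod p) ≠ 0 := by
    rw [Ne, ZMod.natCast_eq_zero_iff, hpp.dvd_factorial]; omega
  apply mul_right_cancel₀ hfac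
  linear_combination -hd3

/-- Each factor is `2i sin(2π(r+1)/p)` with angle in `(0, π)`, so the real part of the product is
positive and its square is known. -/
theorem prod_eq_I_pow_mul {h : ℕ} (hh : p = 2 * h + 1) :
    ∏ r ∈ range h, (Complex.exp (2 * Real.pi * Complex.I / p) ^ (r + 1) -
      Complex.exp (2 * Real.pi * Complex.I / p) ^ (p - (r + 1))) = Complex.I ^ h * (√p : ℝ) := by
  have hp0 : (p : ℂ) ≠ 0 := by exact_mod_cast (Fact.out : p.Prime).ne_zero
  have hpR : (0 : ℝ) < p := by exact_mod_cast (Fact.out : p.Prime).pos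
  have hζ := Complex.isPrimitiveRoot_exp p (Fact.out : p.Prime).ne_zero
  set ζ := Complex.exp (2 * Real.pi * Complex.I / p) with hζdef
  have hterm : ∀ r ∈ range h, ζ ^ (r + 1) - ζ ^ (p - (r + 1)) =
      Complex.I * ((2 * Real.sin (2 * Real.pi * (r + 1) / p) : ℝ) : ℂ) := by
    intro r hr
    have hr' := mem_range.mp hr
    have hz : ζ ^ (p - (r + 1)) = Complex.exp (-(2 * Real.pi * (r + 1) / p) * Complex.I) := by
      have : ζ ^ (r + 1) * ζ ^ (p - (r + 1)) = 1 := by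
        rw [← pow_add, Nat.add_sub_cancel' (by omega), hζ.pow_eq_one]
      rw [eq_comm, neg_mul, Complex.exp_neg, inv_eq_iff_eq_inv, ← eq_inv_of_mul_eq_one_left this,
        hζdef, ← Complex.exp_nat_mul]
      congr 1; push_cast; ring
    have hz2 : ζ ^ (r + 1) = Complex.exp ((2 * Real.pi * (r + 1) / p) * Complex.I) := by
      rw [hζdef, ← Complex.exp_nat_mul]
      congr 1; push_cast; ring
    rw [hz, hz2]
    push_cast
    rw [Complex.two_sin]
    linear_combination (Complex.exp ((2 * Real.pi * (r + 1) / p) * Complex.I) -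
      Complex.exp (-(2 * Real.pi * (r + 1) / p) * Complex.I)) * Complex.I_mul_I
  set t : ℝ := ∏ r ∈ range h, 2 * Real.sin (2 * Real.pi * (r + 1) / p) with ht
  have hD : ∏ r ∈ range h, (ζ ^ (r + 1) - ζ ^ (p - (r + 1))) = Complex.I ^ h * (t : ℂ) := by
    rw [prod_congr rfl hterm, prod_mul_distrib, prod_const, card_range, ht]
    push_cast; rfl
  have htpos : 0 < t := by
    refine prod_pos fun r hr => ?_
    have hr' : ((r : ℝ) + 1) * 2 < p := by
      have := mem_range.mp hr
      have h2 : (r + 1) * 2 < p := by omega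
      exact_mod_cast h2
    refine mul_pos two_pos (Real.sin_pos_of_pos_of_lt_pi (by positivity) ?_)
    rw [div_lt_iff₀ hpR]
    nlinarith [Real.pi_pos]
  have hsq := prod_sq_eq hh hζ
  rw [hD, mul_pow, ← pow_mul, mul_comm h, pow_mul, Complex.I_sq] at hsq
  have hsq' : (t : ℂ) ^ 2 = p := mul_left_cancel₀ (pow_ne_zero h (by norm_num)) hsq
  have hsq2 : t ^ 2 = p := by exact_mod_cast hsq'
  rw [hD, ← hsq2, Real.sqrt_sq htpos.le]

theorem stdAddChar_natCast (j : ℕ) :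
    (ZMod.stdAddChar (j : ZMod p) : ℂ) = Complex.exp (2 * Real.pi * Complex.I / p) ^ j := by
  have h := ZMod.stdAddChar_coe (N := p) (j : ℤ)
  rw [Int.cast_natCast] at h
  rw [h, ← Complex.exp_nat_mul]
  congr 1; push_cast; ring

/-- Gauss's determination of the sign of the quadratic Gauss sum. -/
theorem gaussSum_zmod_eq (hp : Odd p) :
    ∑ j : ZMod p, ((quadraticChar (ZMod p) j : ℤ) : ℂ) * ZMod.stdAddChar j =
      (if p % 4 = 1 then 1 else Complex.I) * (√p : ℝ) := by
  obtain ⟨h, hh⟩ := hp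
  have hpp : p.Prime := Fact.out
  have hchar : ringChar (ZMod p) ≠ 2 := by
    rw [ZMod.ringChar_zmod_n]; omega
  set χ : MulChar (ZMod p) ℂ := (quadraticChar (ZMod p)).ringHomComp (Int.castRingHom ℂ) with hχ
  have hχ1 : χ ≠ 1 := by
    rw [hχ]
    exact (MulChar.ringHomComp_ne_one_iff (RingHom.injective_int _)).mpr (quadraticChar_ne_one hchar)
  have hsq := gaussSum_sq hχ1 ((quadraticChar_isQuadratic (ZMod p)).comp _)
    (ZMod.isPrimitive_stdAddChar p)
  have hneg : χ (-1) = (-1) ^ h := by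
    have h1 : (quadraticChar (ZMod p)) (-1) = (-1) ^ h := by
      rw [quadraticChar_neg_one hchar, ZMod.card, ZMod.χ₄_eq_neg_one_pow (by omega)]
      congr 1; omega
    rw [hχ, MulChar.ringHomComp_apply, h1]; simp
  rw [hneg, ZMod.card] at hsq
  have hζ := Complex.isPrimitiveRoot_exp p hpp.ne_zero
  set ζ := Complex.exp (2 * Real.pi * Complex.I / p) with hζdef
  have hg : ∑ j : ZMod p, ((quadraticChar (ZMod p) j : ℤ) : ℂ) * ZMod.stdAddChar j = gaussSum χ ZMod.stdAddChar := rfl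
  have hrange : ∑ j : ZMod p, ((quadraticChar (ZMod p) j : ℤ) : ℂ) * ZMod.stdAddChar j =
      ∑ j ∈ range p, ((quadraticChar (ZMod p) j : ℤ) : ℂ) * ζ ^ j := by
    symm
    refine sum_nbij' (fun j => (j : ZMod p)) ZMod.val (by simp)
      (fun j _ => mem_range.mpr (ZMod.val_lt j)) (fun j hj => ZMod.val_cast_of_lt (mem_range.mp hj))
      (fun j _ => ZMod.natCast_zmod_val j) fun j _ => ?_
    rw [stdAddChar_natCast]
  rw [← prod_sq_eq hh hζ, ← hg, hrange] at hsq
  obtain ⟨ε, hε, hD⟩ : ∃ ε : ℤ, (ε = 1 ∨ ε = -1) ∧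
      ∑ j ∈ range p, ((quadraticChar (ZMod p) j : ℤ) : ℂ) * ζ ^ j =
      ε * ∏ r ∈ range h, (ζ ^ (r + 1) - ζ ^ (p - (r + 1))) := by
    rcases sq_eq_sq_iff_eq_or_eq_neg.mp hsq with h1 | h1
    · exact ⟨1, Or.inl rfl, by rw [h1]; simp⟩
    · exact ⟨-1, Or.inr rfl, by rw [h1]; simp⟩
  have hcong := sign_congruence p hh hζ ε hD
  -- Euler's criterion replaces `2^h` by the quadratic character of `2`, that is `χ₈(p)`; the
  -- congruence between signs lifts to `ℤ`.
  have hεval : ε * ZMod.χ₈ p = (-1) ^ h := by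
    have h2 := quadraticChar_eq_pow_of_char_ne_two' hchar (2 : ZMod p)
    rw [quadraticChar_two hchar, ZMod.card, show p / 2 = h by omega] at h2
    rw [← h2] at hcong
    have hne : (1 : ZMod p) ≠ -1 := by
      have : Fact (2 < p) := ⟨by have := hpp.two_le; omega⟩
      exact ZMod.neg_one_ne_one.symm
    have h8 : ZMod.χ₈ (p : ZMod 8) = 1 ∨ ZMod.χ₈ (p : ZMod 8) = -1 := by
      rw [ZMod.χ₈_nat_eq_if_mod_eight, if_neg (by omega)]
      split_ifs <;> simp
    rcases hε with rfl | rfl <;> rcases h8 with h8 | h8 <;>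
      rcases neg_one_pow_eq_or ℤ h with h3 | h3 <;>
      (have h4 : ((-1 : ZMod p)) ^ h = (((-1 : ℤ) ^ h : ℤ) : ZMod p) := by push_cast; rfl
       rw [h4, h8, h3] at hcong
       rw [h8, h3]
       simp [hne, hne.symm] at hcong ⊢)
  rw [hrange, hD, prod_eq_I_pow_mul p hh, ← mul_assoc]
  congr 1
  rw [ZMod.χ₈_nat_eq_if_mod_eight, if_neg (by omega)] at hεval
  have hI4 : ∀ t : ℕ, Complex.I ^ (4 * t) = 1 := fun t => by rw [pow_mul, Complex.I_pow_four, one_pow]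
  obtain ⟨t, ht | ht | ht | ht⟩ : ∃ t, h = 4 * t ∨ h = 4 * t + 1 ∨ h = 4 * t + 2 ∨ h = 4 * t + 3 :=
    ⟨h / 4, by omega⟩
  · rw [if_pos (by omega), (show Even h from ⟨2 * t, by omega⟩).neg_one_pow] at hεval
    rw [if_pos (by omega), ht, hI4]
    simp_all
  · rw [if_neg (by omega), (show Odd h from ⟨2 * t, by omega⟩).neg_one_pow] at hεval
    rw [if_neg (by omega), ht, pow_succ, hI4]
    simp_all
  · rw [if_neg (by omega), (show Even h from ⟨2 * t + 1, by omega⟩).neg_one_pow] at hεval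
    have : ε = -1 := by omega
    rw [if_pos (by omega), ht, pow_add, hI4, this, Complex.I_sq]
    simp
  · rw [if_pos (by omega), (show Odd h from ⟨2 * t + 1, by omega⟩).neg_one_pow] at hεval
    have : ε = -1 := by omega
    rw [if_neg (by omega), ht, pow_add, hI4, this, Complex.I_pow_three]
    simp

end GaussSumSign

/-! ### Character sums over squares -/

section QuadraticSums

variable {F : Type*} [Field F] [Fintype F]

theorem etaChar_mul (x y : F) : etaChar (x * y) = etaChar x * etaChar y := by
  rw [etaChar, map_mul, Int.cast_mul]; rfl

theorem etaChar_mul_self {x : F} (hx : x ≠ 0) : etaChar x * etaChar x = 1 := by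
  classical
  rw [← etaChar_mul, etaChar, ← pow_two, quadraticChar_sq_one' hx]
  simp

theorem sum_comp_sq (hF : ringChar F ≠ 2) (f : F → ℂ) :
    ∑ x, f (x ^ 2) = ∑ y, (1 + etaChar y) * f y := by
  classical
  rw [← sum_fiberwise univ (fun x : F => x ^ 2)]
  refine sum_congr rfl fun y _ => ?_
  rw [sum_congr rfl fun x hx => by rw [(mem_filter.mp hx).2], sum_const, nsmul_eq_mul]
  have h := quadraticChar_card_sqrts hF y
  have hset : ({x : F | x ^ 2 = y} : Set F).toFinset = ({x : F | x ^ 2 = y} : Finset F) := by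
    ext x; simp
  rw [hset] at h
  congr 1
  have h2 : ((#{x : F | x ^ 2 = y} : ℤ) : ℂ) = etaChar y + 1 := by
    rw [h, etaChar]; push_cast; congr!
  rw [add_comm, ← h2, Int.cast_natCast]

theorem addChar_map_sum {ι A M : Type*} [AddCommMonoid A] [CommMonoid M] (ψ : AddChar A M)
    (s : Finset ι) (f : ι → A) : ψ (∑ i ∈ s, f i) = ∏ i ∈ s, ψ (f i) :=
  map_prod ψ.toMonoidHom (fun i => Multiplicative.ofAdd (f i)) s

theorem sum_mul_sq (hF : ringChar F ≠ 2) {ψ : AddChar F ℂ} (hψ : ψ.IsPrimitive) {A : F}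
    (hA : A ≠ 0) : ∑ x, ψ (A * x ^ 2) = etaChar A * ∑ y, etaChar y * ψ y := by
  classical
  rw [sum_comp_sq hF fun y => ψ (A * y)]
  simp_rw [add_mul, one_mul, sum_add_distrib]
  have h0 : ∑ x, ψ (A * x) = 0 := by
    simp_rw [mul_comm A]
    rw [AddChar.sum_mulShift A hψ, if_neg hA, Nat.cast_zero]
  rw [h0, zero_add, ← Equiv.sum_comp (Equiv.mulLeft₀ A hA) fun y => etaChar y * ψ y, mul_sum]
  refine sum_congr rfl fun x _ => ?_
  rw [Equiv.mulLeft₀_apply, etaChar_mul, ← mul_assoc, ← mul_assoc, etaChar_mul_self hA, one_mul]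

end QuadraticSums

/-! ### The quadratic Gauss sum of `F` through the trace form -/

section TraceForm

variable {p : ℕ} [Fact p.Prime] {F : Type*} [Field F] [Fintype F] [Algebra (ZMod p) F]

/-- The Moore matrix of a family `v`. -/
def mooreMatrix (p : ℕ) {F : Type*} [Field F] {r : ℕ} (v : Fin r → F) : Matrix (Fin r) (Fin r) F :=
  Matrix.of fun i j => v j ^ p ^ (i : ℕ)

theorem mooreMatrix_transpose_mul (v : Fin (Module.finrank (ZMod p) F) → F) :
    (mooreMatrix p v).transpose * mooreMatrix p v =
      Matrix.of fun i j => algebraMap (ZMod p) F (Algebra.trace (ZMod p) F (v i * v j)) := by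
  ext i j
  rw [Matrix.mul_apply, Matrix.of_apply, FiniteField.algebraMap_trace_eq_sum_pow, Nat.card_zmod,
    sum_range]
  exact sum_congr rfl fun l _ => by simp [mooreMatrix, mul_pow]

/-- Frobenius permutes the rows cyclically, and an `r`-cycle has sign `(-1)^{r-1}`. -/
theorem det_mooreMatrix_pow {r : ℕ} (hF : Fintype.card F = p ^ r) (v : Fin r → F) :
    (mooreMatrix p v).det ^ p = (-1) ^ (r - 1) * (mooreMatrix p v).det := by
  have : CharP F p := charP_of_injective_algebraMap (algebraMap (ZMod p) F).injective p
  have h1 := (frobenius F p).map_det (mooreMatrix p v)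
  rw [frobenius_def] at h1
  have h2 : (frobenius F p).mapMatrix (mooreMatrix p v) =
      (mooreMatrix p v).submatrix (finRotate r) id := by
    ext i j
    rw [RingHom.mapMatrix_apply, Matrix.map_apply, Matrix.submatrix_apply, frobenius_def]
    simp only [mooreMatrix, Matrix.of_apply, id]
    rw [← pow_mul, ← pow_succ]
    rcases r with _ | r
    · exact i.elim0
    · rcases eq_or_ne i (Fin.last r) with rfl | hi
      · rw [finRotate_last, Fin.val_last, ← hF, FiniteField.pow_card]; simp
      · rw [coe_finRotate_of_ne_last hi]
  rw [h1, h2, Matrix.det_permute, sign_finRotate]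
  simp

/-- In an orthogonal basis of the trace form the sum factors into prime-field Gauss sums. The
product of their `η` factors is that of the discriminant, which is the square of the Moore
determinant. -/
theorem sum_chiOne_sq {n : ℕ} (hp : Odd p) (hF : Fintype.card F = p ^ n) :
    ∑ x : F, chiOne p (x ^ 2) =
      (-1) ^ (n - 1) * ((if p % 4 = 1 then 1 else Complex.I) * (√p : ℝ)) ^ n := by
  classical
  have hpp : p.Prime := Fact.out
  have hp2 : p ≠ 2 := by rintro rfl; exact absurd hp (by decide)
  obtain ⟨h, hh⟩ := hp
  have : CharP F p := charP_of_injective_algebraMap (algebraMap (ZMod p) F).injective p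
  have hcharK : ringChar (ZMod p) ≠ 2 := by rwa [ZMod.ringChar_zmod_n]
  have hcard : Fintype.card F = p ^ Module.finrank (ZMod p) F := by
    rw [Module.card_eq_pow_finrank (K := ZMod p), ZMod.card]
  obtain rfl : n = Module.finrank (ZMod p) F := Nat.pow_right_injective hpp.two_le (hF.symm.trans hcard)
  have h2 : (2 : ZMod p) ≠ 0 := Ring.two_ne_zero hcharK
  let : Invertible (2 : ZMod p) := invertibleOfNonzero h2
  obtain ⟨v, hv⟩ := LinearMap.BilinForm.exists_orthogonal_basis
    (LinearMap.BilinForm.isSymm_iff.mp (Algebra.traceForm_isSymm (ZMod p) (S := F)))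
  set w : Fin (Module.finrank (ZMod p) F) → ZMod p := fun i => Algebra.trace (ZMod p) F (v i * v i)
    with hw
  have horth : ∀ i j, Algebra.trace (ZMod p) F (v i * v j) = if i = j then w i else 0 := by
    intro i j
    split_ifs with hij
    · rw [hij]
    · exact hv hij
  have hmat : (mooreMatrix p v).transpose * mooreMatrix p v =
      Matrix.diagonal fun i => algebraMap (ZMod p) F (w i) := by
    rw [mooreMatrix_transpose_mul]
    ext i j
    rw [Matrix.of_apply, horth, Matrix.diagonal_apply]
    split_ifs <;> simp
  have hdet : (mooreMatrix p v).det ^ 2 = algebraMap (ZMod p) F (∏ i, w i) := by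
    have := congrArg Matrix.det hmat
    rw [Matrix.det_mul, Matrix.det_transpose, Matrix.det_diagonal] at this
    rw [pow_two, this, map_prod]
  have hw0 : ∀ i, w i ≠ 0 := hv.not_isOrtho_basis_self_of_separatingLeft
    (traceForm_nondegenerate (ZMod p) F).1
  have hW0 : ∏ i, w i ≠ 0 := prod_ne_zero_iff.mpr fun i _ => hw0 i
  have hdet0 : (mooreMatrix p v).det ≠ 0 := by
    intro h0
    rw [h0, zero_pow two_ne_zero, eq_comm, map_eq_zero] at hdet
    exact hW0 hdet
  have hsign : etaChar (∏ i, w i) = (-1) ^ (Module.finrank (ZMod p) F - 1) := by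
    have h3 := det_mooreMatrix_pow hF v
    -- With `p = 2h+1`, the `h`-th power of the discriminant is `det^{p-1}`, which is the sign from
    -- the Frobenius action; Euler's criterion then gives the quadratic character.
    have h4 : algebraMap (ZMod p) F ((∏ i, w i) ^ h) = (-1) ^ (Module.finrank (ZMod p) F - 1) := by
      apply mul_right_cancel₀ hdet0
      rw [← h3, map_pow, ← hdet, ← pow_mul, ← pow_succ, ← hh]
    have h5 := quadraticChar_eq_pow_of_char_ne_two hcharK hW0
    rw [ZMod.card, show p / 2 = h by omega] at h5
    have h6 : etaChar (∏ i, w i) = ((quadraticChar (ZMod p) (∏ i, w i) : ℤ) : ℂ) := by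
      rw [etaChar]; congr!
    rw [h6, h5]
    have hinj := (algebraMap (ZMod p) F).injective
    rcases neg_one_pow_eq_or ℤ (Module.finrank (ZMod p) F - 1) with h7 | h7
    · have h8 : (-1 : F) ^ (Module.finrank (ZMod p) F - 1) = 1 := by exact_mod_cast congrArg (Int.cast (R := F)) h7
      have h9 : (-1 : ℂ) ^ (Module.finrank (ZMod p) F - 1) = 1 := by exact_mod_cast congrArg (Int.cast (R := ℂ)) h7
      rw [h8, ← map_one (algebraMap (ZMod p) F)] at h4
      rw [if_pos (hinj h4), h9, Int.cast_one]
    · have h8 : (-1 : F) ^ (Module.finrank (ZMod p) F - 1) = -1 := by exact_mod_cast congrArg (Int.cast (R := F)) h7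
      have h9 : (-1 : ℂ) ^ (Module.finrank (ZMod p) F - 1) = -1 := by exact_mod_cast congrArg (Int.cast (R := ℂ)) h7
      rw [h8, ← map_one (algebraMap (ZMod p) F), ← map_neg] at h4
      have hne : (-1 : ZMod p) ≠ 1 := Ring.neg_one_ne_one_of_char_ne_two hcharK
      rw [if_neg (by rw [hinj h4]; exact hne), h9]
      simp
  have hexp : ∀ c : Fin (Module.finrank (ZMod p) F) → ZMod p,
      chiOne p ((v.equivFun.symm c) ^ 2) = ∏ i, ZMod.stdAddChar (w i * c i ^ 2) := by
    intro c
    rw [chiOne_apply, ← addChar_map_sum, v.equivFun_symm_apply, pow_two, sum_mul_sum, map_sum]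
    congr 1
    refine sum_congr rfl fun i _ => ?_
    rw [map_sum]
    have : ∀ j, Algebra.trace (ZMod p) F (c i • v i * c j • v j) =
        if i = j then w i * c i ^ 2 else 0 := by
      intro j
      rw [smul_mul_smul_comm, map_smul, horth, smul_eq_mul]
      split_ifs with hij
      · rw [← hij]; ring
      · rw [mul_zero]
    rw [sum_congr rfl fun j _ => this j, sum_ite_eq, if_pos (mem_univ i)]
  rw [← Equiv.sum_comp v.equivFun.symm.toEquiv fun x => chiOne p (x ^ 2)]
  have hg : ∑ y : ZMod p, etaChar y * ZMod.stdAddChar y =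
      (if p % 4 = 1 then 1 else Complex.I) * (√p : ℝ) := by
    rw [← gaussSum_zmod_eq p ⟨h, hh⟩]
    refine sum_congr rfl fun y _ => ?_
    rw [etaChar]; congr!
  have hprod : ∏ i, etaChar (w i) = etaChar (∏ i, w i) := by
    simp [etaChar, map_prod]
  calc ∑ c, chiOne p ((v.equivFun.symm c) ^ 2)
      = ∑ c : Fin (Module.finrank (ZMod p) F) → ZMod p, ∏ i, ZMod.stdAddChar (w i * c i ^ 2) :=
        sum_congr rfl fun c _ => hexp c
    _ = ∏ i, ∑ y : ZMod p, ZMod.stdAddChar (w i * y ^ 2) :=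
        (Fintype.prod_sum fun i y => (ZMod.stdAddChar (w i * y ^ 2) : ℂ)).symm
    _ = ∏ i, (etaChar (w i) * ((if p % 4 = 1 then 1 else Complex.I) * (√p : ℝ))) :=
        prod_congr rfl fun i _ => by
          rw [sum_mul_sq hcharK (ZMod.isPrimitive_stdAddChar p) (hw0 i), hg]
    _ = _ := by
        rw [prod_mul_distrib, hprod, hsign, prod_const, card_univ, Fintype.card_fin]

theorem sum_chiOne_sq_eq_epsP {n : ℕ} (hp : Odd p) (hF : Fintype.card F = p ^ n) :
    ∑ x : F, chiOne p (x ^ 2) = (-1) ^ (n - 1) * epsP p n * (√((p : ℝ) ^ n) : ℝ) := by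
  rw [sum_chiOne_sq hp hF, mul_pow, mul_assoc, epsP]
  have : √((p : ℝ) ^ n) = √(p : ℝ) ^ n := by
    rw [Real.sqrt_eq_iff_mul_self_eq (by positivity) (by positivity), ← mul_pow,
      Real.mul_self_sqrt (by positivity)]
  rw [this]
  split_ifs <;> simp

end TraceForm

/-! ### Evaluation of the pure Gold sum for `n/d` odd -/

section OddCase

/-- The gcd divides `p^{gcd(n,2k)} - 1 = p^d - 1`, hence `p^k - 1` as well as `p^k + 1`. -/
theorem gcd_pow_add_one_of_odd {p n k : ℕ} (hp : Odd p) (hp1 : 1 < p) (hodd : Odd (n / n.gcd k)) :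
    (p ^ n - 1).gcd (p ^ k + 1) = 2 := by
  have h1 : (p ^ n - 1).gcd (p ^ k + 1) ∣ p ^ k - 1 := by
    have hk : p ^ k + 1 ∣ p ^ (2 * k) - 1 := by
      rw [mul_comm 2, pow_mul]
      exact ⟨p ^ k - 1, by rw [← Nat.sq_sub_sq, one_pow]⟩
    have h := Nat.gcd_dvd_gcd_of_dvd_right (p ^ n - 1) hk
    rw [Nat.pow_sub_one_gcd_pow_sub_one, gcd_two_mul_of_odd hodd] at h
    exact h.trans (Nat.pow_sub_one_dvd_pow_sub_one p (Nat.gcd_dvd_right _ _))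
  have h2 : (p ^ n - 1).gcd (p ^ k + 1) ∣ 2 := by
    have h := Nat.dvd_sub (Nat.gcd_dvd_right (p ^ n - 1) (p ^ k + 1)) h1
    have hpos : 0 < p ^ k := Nat.pow_pos (by omega)
    rwa [show p ^ k + 1 - (p ^ k - 1) = 2 by omega] at h
  refine Nat.dvd_antisymm h2 (Nat.dvd_gcd ?_ ?_)
  · exact (hp.pow.tsub_odd odd_one).two_dvd
  · exact (hp.pow.add_odd odd_one).two_dvd

variable {p n k : ℕ} [Fact p.Prime] {F : Type*} [Field F] [Fintype F] [Algebra (ZMod p) F]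

theorem goldSum_zero_of_odd (hp : Odd p) (hF : Fintype.card F = p ^ n)
    (hodd : Odd (n / n.gcd k)) {A : F} (hA : A ≠ 0) :
    goldSum p k A 0 = (-1) ^ (n - 1) * epsP p n * (√((p : ℝ) ^ n) : ℝ) * etaChar A := by
  have hp1 : 1 < p := (Fact.out : p.Prime).one_lt
  have hchar : ringChar F ≠ 2 := by
    have : CharP F p := charP_of_injective_algebraMap (algebraMap (ZMod p) F).injective p
    rw [ringChar.eq F p]
    rintro rfl
    exact absurd hp (by decide)
  have hg2 : (p ^ n - 1).gcd 2 = 2 := Nat.gcd_eq_right (hp.pow.tsub_odd odd_one).two_dvd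
  have h1 := sum_pow_eq_sum_card hF (M := p ^ k + 1) (by omega) fun x => chiOne p (A * x)
  have h2 := sum_pow_eq_sum_card hF (M := 2) two_ne_zero fun x => chiOne p (A * x)
  rw [gcd_pow_add_one_of_odd hp hp1 hodd] at h1
  rw [hg2, ← h1] at h2
  have h3 : goldSum p k A 0 = ∑ x : F, chiOne p (A * x ^ (p ^ k + 1)) := by simp [goldSum]
  have h4 := sum_mul_sq hchar (chiOne_isPrimitive p) (one_ne_zero (α := F))
  have h5 : etaChar (1 : F) = 1 := by simp [etaChar]
  simp only [one_mul, h5] at h4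
  rw [h3, ← h2, sum_mul_sq hchar (chiOne_isPrimitive p) hA, ← h4, sum_chiOne_sq_eq_epsP hp hF,
    mul_comm]

end OddCase

/-! ### Reduction of the table entry to Weil sums, and the three cases -/

section Assembly

variable {F : Type*} [Field F]

/-- Since `k ≠ 0`, the terms of the coefficients `a_i'` split as a sum. -/
theorem coefPrime_eq {p k : ℕ} (hk : 1 ≤ k) (u : ℕ → F) (c a α : F) (i : ℕ) :
    coefPrime p k u c a α i = coefA c α * u i + (if i = 0 then α * a ^ p ^ k else 0) +
      (if i = k then α * a else 0) := by
  rw [coefPrime, coefA]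
  split_ifs with h0 h1 h1
  · omega
  · rw [h0]; ring
  · rw [h1]; ring
  · ring

theorem coefA_ne_zero {c α : F} (hc : c ≠ 1) (hα : α ≠ 0) : coefA c α ≠ 0 :=
  mul_ne_zero hα (sub_ne_zero.mpr hc.symm)

variable {p n k : ℕ} [Fact p.Prime]

theorem linPoly_add [CharP F p] (u : ℕ → F) (x y : F) :
    linPoly p n u (x + y) = linPoly p n u x + linPoly p n u y := by
  simp only [linPoly, add_pow_char_pow, mul_add, sum_add_distrib]

variable [Fintype F]

theorem goldLin_ker_trivial (hp : Odd p) (hn : n ≠ 0) (hF : Fintype.card F = p ^ n) {A : F}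
    (hA : A ≠ 0)
    (h : A ^ ((p ^ k - 1) * ((p ^ n - 1) / (p ^ n.gcd (2 * k) - 1))) ≠ (-1) ^ (n / n.gcd (2 * k)))
    (x : F) (hx : goldLin p k A x = 0) : x = 0 := by
  classical
  have hc := card_goldLin_ker (k := k) hp hn hF hA
  rw [if_neg h] at hc
  exact card_le_one.mp hc.le x (by simpa using hx) 0 (by simpa using goldLin_zero A)

variable [Algebra (ZMod p) F]

theorem weilS_eq_goldSum (u : ℕ → F) (c a α : F) :
    weilS p n k u c a α = goldSum p k (coefA c α) (coefB p n k u c a α) := rfl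

theorem chiOne_coefPrime_mul (hF : Fintype.card F = p ^ n) (y x : F) {i : ℕ} (hi : i ≤ n) :
    chiOne p (y ^ p ^ (n - i) * x) = chiOne p (y * x ^ p ^ i) := by
  rw [← chiOne_pow_char_pow p (y ^ p ^ (n - i) * x) i, mul_pow, ← pow_mul, ← pow_add,
    Nat.sub_add_cancel hi, ← hF, FiniteField.pow_card]

/-- `B_α` represents the additive part of the exponent: each `a_i' x^{p^i}` is traced against `x` by
the adjoint Frobenius. -/
theorem chiOne_coefB_mul (hF : Fintype.card F = p ^ n) (hk : 1 ≤ k) (hkn : k < n) (u : ℕ → F)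
    (c a α x : F) : chiOne p (coefB p n k u c a α * x) =
      chiOne p (α * ((1 - c) * linPoly p n u x + a ^ p ^ k * x + a * x ^ p ^ k)) := by
  rw [coefB, sum_mul, addChar_map_sum, prod_congr rfl fun i hi =>
    chiOne_coefPrime_mul hF (coefPrime p k u c a α i) x (mem_range.mp hi).le, ← addChar_map_sum]
  congr 1
  simp only [coefPrime_eq hk, add_mul, sum_add_distrib, ite_mul, zero_mul, sum_ite_eq', mem_range,
    hkn, show 0 < n by omega, if_true, linPoly, coefA, mul_add, mul_sum, pow_zero, pow_one]
  congr 1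
  · congr 1
    · exact sum_congr rfl fun i _ => by ring
    · ring
  · ring

theorem coefB_eq (hF : Fintype.card F = p ^ n) (hk : 1 ≤ k) (hkn : k < n) (u : ℕ → F)
    (c a α : F) : coefB p n k u c a α =
      α * a ^ p ^ k + α ^ p ^ (n - k) * a ^ p ^ (n - k) + companion p n u c α := by
  have : CharP F p := charP_of_injective_algebraMap (algebraMap (ZMod p) F).injective p
  have hp0 : p ≠ 0 := (Fact.out : p.Prime).ne_zero
  have hz : ∀ j, p ^ j ≠ 0 := fun j => pow_ne_zero j hp0
  have hq : ∀ y : F, y ^ p ^ n = y := fun y => by rw [← hF, FiniteField.pow_card]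
  simp only [coefB, coefPrime_eq hk, add_pow_char_pow, sum_add_distrib, companion, ite_pow, zero_pow (hz _),
    sum_ite_eq', mem_range, hkn, show 0 < n by omega, if_true, Nat.sub_zero, hq, mul_pow, coefA]
  rw [add_assoc, add_comm]
  congr 1
  exact sum_congr rfl fun i _ => by ring

theorem mem_setX_iff (hF : Fintype.card F = p ^ n) (hk : 1 ≤ k) (hkn : k < n) (u : ℕ → F)
    (c a α : F) : α ∈ setX p n k u c a ↔ α ≠ 0 ∧ coefB p n k u c a α = 0 := by
  rw [coefB_eq hF hk hkn]; simp [setX]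

theorem mem_setXbar_iff (hF : Fintype.card F = p ^ n) (hk : 1 ≤ k) (hkn : k < n) (u : ℕ → F)
    (c a α : F) : α ∈ setXbar p n k u c a ↔ α ≠ 0 ∧ coefB p n k u c a α ≠ 0 := by
  simp only [setXbar, mem_filter, mem_univ, true_and, mem_setX_iff hF hk hkn]; tauto

theorem cDDT_eq (hF : Fintype.card F = p ^ n) (hk : 1 ≤ k) (hkn : k < n) (u : ℕ → F)
    (a b c : F) :
    (cDDT (pertGold p n k u) c a b : ℂ) = 1 + ((p : ℂ) ^ n)⁻¹ * sumT p n k u c a b := by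
  classical
  have : CharP F p := charP_of_injective_algebraMap (algebraMap (ZMod p) F).injective p
  have hq : (p : ℂ) ^ n ≠ 0 := pow_ne_zero _ (by exact_mod_cast (Fact.out : p.Prime).ne_zero)
  have hFc : (Fintype.card F : ℂ) = (p : ℂ) ^ n := by rw [hF]; push_cast; rfl
  have hterm : ∀ α x : F,
      chiOne p (α * (pertGold p n k u (x + a) - c * pertGold p n k u x - b)) =
      chiOne p (α * (pPrime p n k u a - b)) *
        chiOne p (coefA c α * x ^ (p ^ k + 1) + coefB p n k u c a α * x) := by
    intro α x
    rw [AddChar.map_add_eq_mul _ (coefA c α * _), chiOne_coefB_mul hF hk hkn,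
      ← AddChar.map_add_eq_mul, ← AddChar.map_add_eq_mul]
    congr 1
    rw [pertGold, pertGold, linPoly_add, add_pow_gold, pPrime, coefA]
    ring
  have h1 : ∑ α : F, ∑ x : F,
      chiOne p (α * (pertGold p n k u (x + a) - c * pertGold p n k u x - b)) =
      (p : ℂ) ^ n * cDDT (pertGold p n k u) c a b := by
    rw [sum_comm]
    simp_rw [sum_chiOne_mul, sub_eq_zero, hFc]
    rw [cDDT, card_filter, Nat.cast_sum, mul_sum]
    refine sum_congr rfl fun x _ => ?_
    split_ifs <;> simp
  have h2 : ∑ α : F, ∑ x : F,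
      chiOne p (α * (pertGold p n k u (x + a) - c * pertGold p n k u x - b)) =
      (p : ℂ) ^ n + sumT p n k u c a b := by
    rw [Fintype.sum_eq_add_sum_compl 0]
    congr 1
    · simp [hFc]
    · rw [sumT]
      refine sum_congr (by ext; simp) fun α _ => ?_
      rw [weilS, mul_sum]
      exact sum_congr rfl fun x _ => hterm α x
  rw [h1] at h2
  field_simp
  linear_combination h2

/-- `T_{a,b}` splits over `X_a` and its complement. -/
theorem sumT_eq_add (u : ℕ → F) (a b c : F) :
    sumT p n k u c a b =
      ∑ α ∈ setX p n k u c a, chiOne p (α * (pPrime p n k u a - b)) * weilS p n k u c a α +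
      ∑ α ∈ setXbar p n k u c a, chiOne p (α * (pPrime p n k u a - b)) * weilS p n k u c a α := by
  classical
  rw [sumT, ← sum_filter_add_sum_filter_not _ fun α => α ∈ setX p n k u c a]
  congr 1
  · refine sum_congr ?_ fun _ _ => rfl
    ext α
    simp only [mem_filter, mem_univ, true_and, and_iff_right_iff_imp]
    intro h
    exact (mem_filter.mp h).2.1
  · refine sum_congr ?_ fun _ _ => rfl
    ext α
    simp [setXbar]

theorem weilS_of_mem_setX (hF : Fintype.card F = p ^ n) (hk : 1 ≤ k) (hkn : k < n) {u : ℕ → F}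
    {c a α : F} (h : α ∈ setX p n k u c a) :
    weilS p n k u c a α = goldSum p k (coefA c α) 0 := by
  rw [weilS_eq_goldSum, ((mem_setX_iff hF hk hkn u c a α).mp h).2]

theorem chiOne_mul_weilS_of_isSolL {u : ℕ → F} {c a b α : F} {x : F → F}
    (h : IsSolL p n k u c a α (x α)) :
    chiOne p (α * (pPrime p n k u a - b)) * weilS p n k u c a α =
      chiOne p (α * deltaC p n k u c a b x α) * goldSum p k (coefA c α) 0 := by
  have : CharP F p := charP_of_injective_algebraMap (algebraMap (ZMod p) F).injective p
  rw [weilS_eq_goldSum, goldSum_of_goldLin_eq h, ← mul_assoc, ← AddChar.map_add_eq_mul]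
  congr 2
  rw [deltaC, coefA]; ring

theorem existsUnique_isSolL {u : ℕ → F} {c a α : F}
    (h : ∀ x, goldLin p k (coefA c α) x = 0 → x = 0) :
    ∃! y : F, IsSolL p n k u c a α y := by
  have : CharP F p := charP_of_injective_algebraMap (algebraMap (ZMod p) F).injective p
  exact (goldLin_bijective h).existsUnique _

theorem sumT_of_even (hp : Odd p) (hk : 1 ≤ k) (hkn : k < n)
    (hF : Fintype.card F = p ^ n) (u : ℕ → F) (a b c : F) (x : F → F)
    (hx : ∀ α ∈ setXbar p n k u c a,
      (∃ y : F, IsSolL p n k u c a α y) → IsSolL p n k u c a α (x α))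
    (heven : Even (n / n.gcd k)) (hc : c ≠ 1) {m : ℕ} (hm : n = 2 * m) :
    (∀ α ∈ setVEven p n k u c a, ∃! y : F, IsSolL p n k u c a α y) ∧
      sumT p n k u c a b =
        (-1) ^ (m / n.gcd k) * (p : ℂ) ^ m * sigmaX p n k u c a b
        + (-1) ^ (m / n.gcd k + 1) * (p : ℂ) ^ m * sigmaOne p n k u c a b
            * ((p : ℂ) ^ n.gcd k + 1)
        + (-1) ^ (m / n.gcd k) * (p : ℂ) ^ m *
            ∑ α ∈ setVEven p n k u c a, chiOne p (α * deltaC p n k u c a b x α)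
        + (-1) ^ (m / n.gcd k + 1) * (p : ℂ) ^ (m + n.gcd k) *
            ∑ α ∈ setSolvable p n k u c a, chiOne p (α * deltaC p n k u c a b x α) := by
  classical
  have hn : n ≠ 0 := by omega
  have hchar : CharP F p := charP_of_injective_algebraMap (algebraMap (ZMod p) F).injective p
  have hV : ∀ α ∈ setVEven p n k u c a, ∃! y : F, IsSolL p n k u c a α y := by
    intro α hα
    obtain ⟨hα1, hα2⟩ := mem_filter.mp hα
    have hA := coefA_ne_zero hc ((mem_setXbar_iff hF hk hkn u c a α).mp hα1).1
    exact existsUnique_isSolL (goldLin_ker_trivial hp hn hF hA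
      (mt (kernel_condition_iff_of_even hn hF heven hA).mp hα2))
  refine ⟨hV, ?_⟩
  have hX : ∑ α ∈ setX p n k u c a,
      chiOne p (α * (pPrime p n k u a - b)) * weilS p n k u c a α =
      (-1) ^ (m / n.gcd k) * (p : ℂ) ^ m * sigmaX p n k u c a b
        + (-1) ^ (m / n.gcd k + 1) * (p : ℂ) ^ m * sigmaOne p n k u c a b
            * ((p : ℂ) ^ n.gcd k + 1) := by
    have hone : sigmaOne p n k u c a b = ∑ α ∈ setX p n k u c a,
        if coefA c α ^ ((p ^ n - 1) / (p ^ n.gcd k + 1)) = (-1) ^ (n / (2 * n.gcd k))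
        then chiOne p (α * (pPrime p n k u a - b)) else 0 := by
      rw [sigmaOne, ← sum_filter]
      refine sum_congr ?_ fun _ _ => rfl
      ext α
      simp only [setXdiffW, setW, mem_sdiff, mem_filter]
      tauto
    rw [hone, sigmaX, mul_sum, mul_sum, sum_mul, ← sum_add_distrib]
    refine sum_congr rfl fun α hα => ?_
    have hA := coefA_ne_zero hc ((mem_setX_iff hF hk hkn u c a α).mp hα).1
    rw [weilS_of_mem_setX hF hk hkn hα, goldSum_zero_of_even hp hn hF heven hm hA]
    split_ifs <;> ring
  have hXbar : ∑ α ∈ setXbar p n k u c a,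
      chiOne p (α * (pPrime p n k u a - b)) * weilS p n k u c a α =
      (-1) ^ (m / n.gcd k) * (p : ℂ) ^ m *
            ∑ α ∈ setVEven p n k u c a, chiOne p (α * deltaC p n k u c a b x α)
        + (-1) ^ (m / n.gcd k + 1) * (p : ℂ) ^ (m + n.gcd k) *
            ∑ α ∈ setSolvable p n k u c a, chiOne p (α * deltaC p n k u c a b x α) := by
    rw [← sum_sdiff (filter_subset _ _ : setVEven p n k u c a ⊆ setXbar p n k u c a), add_comm]
    congr 1
    · rw [mul_sum]
      refine sum_congr rfl fun α hα => ?_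
      obtain ⟨hα1, hα2⟩ := mem_filter.mp hα
      have hA := coefA_ne_zero hc ((mem_setXbar_iff hF hk hkn u c a α).mp hα1).1
      rw [chiOne_mul_weilS_of_isSolL (hx α hα1 (hV α hα).exists),
        goldSum_zero_of_even hp hn hF heven hm hA, if_neg hα2, mul_comm]
    · rw [setSolvable, sum_filter, mul_sum]
      refine sum_congr (by congr!) fun α hα => ?_
      obtain ⟨hα1, hα2⟩ := mem_sdiff.mp hα
      have hA := coefA_ne_zero hc ((mem_setXbar_iff hF hk hkn u c a α).mp hα1).1
      have hα3 : coefA c α ^ ((p ^ n - 1) / (p ^ n.gcd k + 1)) = (-1) ^ (n / (2 * n.gcd k)) := by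
        by_contra h
        exact hα2 (mem_filter.mpr ⟨hα1, h⟩)
      split_ifs with hs
      · rw [chiOne_mul_weilS_of_isSolL (hx α hα1 hs),
          goldSum_zero_of_even hp hn hF heven hm hA, if_pos hα3, mul_comm]
      · rw [weilS_eq_goldSum, goldSum_eq_zero_of_forall_ne hp (fun y hy => hs ⟨y, hy⟩), mul_zero,
          mul_zero]
  rw [sumT_eq_add, hX, hXbar]
  ring

theorem sumT_of_eq_one (hF : Fintype.card F = p ^ n) (hk : 1 ≤ k) (hkn : k < n) (u : ℕ → F)
    (a b : F) : sumT p n k u 1 a b = (p : ℂ) ^ n * sigmaX p n k u 1 a b := by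
  classical
  have hS : ∀ α, weilS p n k u 1 a α = if coefB p n k u 1 a α = 0 then (p : ℂ) ^ n else 0 := by
    intro α
    have h := sum_chiOne_mul p (coefB p n k u 1 a α)
    have hFc : (Fintype.card F : ℂ) = (p : ℂ) ^ n := by rw [hF]; push_cast; rfl
    rw [hFc] at h
    rw [← h, weilS]
    exact sum_congr rfl fun x _ => by rw [coefA, sub_self, mul_zero, zero_mul, zero_add, mul_comm]
  rw [sumT_eq_add, sigmaX, mul_sum]
  have h0 : ∑ α ∈ setXbar p n k u 1 a,
      chiOne p (α * (pPrime p n k u a - b)) * weilS p n k u 1 a α = 0 :=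
    sum_eq_zero fun α hα => by
      rw [hS, if_neg ((mem_setXbar_iff hF hk hkn u 1 a α).mp hα).2, mul_zero]
  rw [h0, add_zero]
  refine sum_congr rfl fun α hα => ?_
  rw [hS, if_pos ((mem_setX_iff hF hk hkn u 1 a α).mp hα).2, mul_comm]

/-- Here `e = d`, so the exponent is a positive multiple of `q - 1` and the power is `1` or `0`,
while the right side is `-1`. Hence for `A ≠ 0` the kernel is always trivial and `V_a` is all of the
complement of `X_a`. -/
theorem kernel_condition_of_odd (hp : Odd p) (hk : 1 ≤ k) (hF : Fintype.card F = p ^ n)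
    (hodd : Odd (n / n.gcd k)) (A : F) :
    A ^ ((p ^ k - 1) * ((p ^ n - 1) / (p ^ n.gcd (2 * k) - 1))) ≠ (-1) ^ (n / n.gcd (2 * k)) := by
  have hp1 : 1 < p := (Fact.out : p.Prime).one_lt
  have hn : n ≠ 0 := by rintro rfl; simp at hodd
  have hchar : ringChar F ≠ 2 := by
    have : CharP F p := charP_of_injective_algebraMap (algebraMap (ZMod p) F).injective p
    rw [ringChar.eq F p]
    rintro rfl
    exact absurd hp (by decide)
  rw [gcd_two_mul_of_odd hodd, hodd.neg_one_pow]
  set d := n.gcd k with hd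
  have hdpos : 0 < d := Nat.gcd_pos_of_pos_left _ (Nat.pos_of_ne_zero hn)
  have hQ : 1 < p ^ d := Nat.one_lt_pow hdpos.ne' hp1
  obtain ⟨s, hs⟩ : p ^ d - 1 ∣ p ^ k - 1 := Nat.pow_sub_one_dvd_pow_sub_one p (Nat.gcd_dvd_right _ _)
  have hdn : p ^ d - 1 ∣ p ^ n - 1 := Nat.pow_sub_one_dvd_pow_sub_one p (Nat.gcd_dvd_left _ _)
  rw [hs, mul_right_comm, Nat.mul_div_cancel' hdn, ← hF]
  have hspos : s ≠ 0 := by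
    rintro rfl
    have := Nat.one_lt_pow (by omega : k ≠ 0) hp1
    omega
  have hne : (-1 : F) ≠ 1 := Ring.neg_one_ne_one_of_char_ne_two hchar
  rcases eq_or_ne A 0 with rfl | hA
  · have : Fintype.card F - 1 ≠ 0 := by
      have := Fintype.one_lt_card (α := F)
      omega
    rw [zero_pow (mul_ne_zero this hspos)]
    exact (neg_ne_zero.mpr one_ne_zero).symm
  · rw [pow_mul, FiniteField.pow_card_sub_one_eq_one A hA, one_pow]
    exact hne.symm

theorem setVOdd_eq (hp : Odd p) (hk : 1 ≤ k) (hF : Fintype.card F = p ^ n)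
    (hodd : Odd (n / n.gcd k)) (u : ℕ → F) (c a : F) :
    setVOdd p n k u c a = setXbar p n k u c a := by
  classical
  rw [setVOdd, filter_true_of_mem]
  exact fun α _ => kernel_condition_of_odd hp hk hF hodd _

theorem etaChar_neg_one_mul_muP (hp : Odd p) (hF : Fintype.card F = p ^ n) :
    muP p n * etaChar (-1 : F) = epsP p n := by
  classical
  have hchar : ringChar F ≠ 2 := by
    have : CharP F p := charP_of_injective_algebraMap (algebraMap (ZMod p) F).injective p
    rw [ringChar.eq F p]
    rintro rfl
    exact absurd hp (by decide)
  have h1 : etaChar (-1 : F) = ((ZMod.χ₄ (p : ZMod 4) ^ n : ℤ) : ℂ) := by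
    have := quadraticChar_neg_one (F := F) hchar
    rw [hF, Nat.cast_pow, map_pow] at this
    rw [← this, etaChar]
  rw [h1, muP, epsP]
  have hp2 : p % 2 = 1 := Nat.odd_iff.mp hp
  split_ifs with h
  · rw [ZMod.χ₄_nat_one_mod_four h]; simp
  · rw [ZMod.χ₄_nat_three_mod_four (by omega), pow_mul, Complex.I_pow_three]
    push_cast
    rw [← mul_pow]; simp

theorem sumT_of_odd (hp : Odd p) (hk : 1 ≤ k) (hkn : k < n)
    (hF : Fintype.card F = p ^ n) (u : ℕ → F) (a b c : F) (x : F → F)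
    (hx : ∀ α ∈ setXbar p n k u c a,
      (∃ y : F, IsSolL p n k u c a α y) → IsSolL p n k u c a α (x α))
    (hodd : Odd (n / n.gcd k)) (hca : c ≠ 1 ∨ a ≠ 0) :
    (c ≠ 1 → ∀ α ∈ setVOdd p n k u c a, ∃! y : F, IsSolL p n k u c a α y) ∧
      sumT p n k u c a b =
        (-1) ^ (n - 1) * epsP p n * (Real.sqrt ((p : ℝ) ^ n) : ℂ) * etaChar (1 - c) *
            incGaussSum (setX p n k u c a) etaChar
              (fun α => chiOne p ((pPrime p n k u a - b) * α))
        + (-1) ^ (n - 1) * muP p n * (Real.sqrt ((p : ℝ) ^ n) : ℂ) * etaChar (c - 1) *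
            incGaussSum (setVOdd p n k u c a) etaChar
              (fun α => chiOne p (deltaC p n k u c a b x α * α)) := by
  classical
  have hn : n ≠ 0 := by omega
  have hV : c ≠ 1 → ∀ α ∈ setVOdd p n k u c a, ∃! y : F, IsSolL p n k u c a α y := by
    intro hc α hα
    rw [setVOdd_eq hp hk hF hodd] at hα
    have hA := coefA_ne_zero hc ((mem_setXbar_iff hF hk hkn u c a α).mp hα).1
    exact existsUnique_isSolL
      (goldLin_ker_trivial hp hn hF hA (kernel_condition_of_odd hp hk hF hodd _))
  refine ⟨hV, ?_⟩
  rcases eq_or_ne c 1 with rfl | hc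
  · have ha : a ≠ 0 := hca.resolve_left (fun h => h rfl)
    -- For `c = 1` the right side is zero because `η(0) = 0`, so `Σ` must vanish. An `α` in `X_a`
    -- would put `a ≠ 0` in the trivial kernel of `L` with coefficient `α`.
    have hempty : setX p n k u 1 a = ∅ := by
      rw [eq_empty_iff_forall_notMem]
      intro α hα
      obtain ⟨hα0, hB⟩ := (mem_setX_iff hF hk hkn u 1 a α).mp hα
      have : CharP F p := charP_of_injective_algebraMap (algebraMap (ZMod p) F).injective p
      have hcomp : companion p n u 1 α = 0 := by
        refine sum_eq_zero fun i _ => ?_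
        rw [sub_self, zero_mul, zero_pow (pow_ne_zero _ (Fact.out : p.Prime).ne_zero), zero_mul]
      rw [coefB_eq hF hk hkn, hcomp, add_zero] at hB
      have hL : goldLin p k α a = 0 := by
        have h2 : (α * a ^ p ^ k + α ^ p ^ (n - k) * a ^ p ^ (n - k)) ^ p ^ k = 0 := by
          rw [hB, zero_pow (pow_ne_zero _ (Fact.out : p.Prime).ne_zero)]
        have hq : ∀ y : F, y ^ p ^ n = y := fun y => by rw [← hF, FiniteField.pow_card]
        rw [add_pow_char_pow, mul_pow, mul_pow, ← pow_mul, ← pow_mul, ← pow_mul, ← pow_add,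
          ← pow_add, Nat.sub_add_cancel hkn.le, hq, hq] at h2
        rw [goldLin, two_mul, h2]
      exact ha (goldLin_ker_trivial hp hn hF hα0 (kernel_condition_of_odd hp hk hF hodd _) a hL)
    rw [sumT_of_eq_one hF hk hkn, sigmaX, hempty]
    simp [incGaussSum, etaChar]
  · have hneg : etaChar (1 - c) = etaChar (-1 : F) * etaChar (c - 1) := by
      rw [← etaChar_mul]; congr 1; ring
    have heta : ∀ α, α ≠ 0 → goldSum p k (coefA c α) 0 =
        (-1) ^ (n - 1) * epsP p n * (√((p : ℝ) ^ n) : ℝ) * etaChar (1 - c) * etaChar α := by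
      intro α hα
      rw [goldSum_zero_of_odd hp hF hodd (coefA_ne_zero hc hα), coefA, etaChar_mul]; ring
    rw [sumT_eq_add, setVOdd_eq hp hk hF hodd, incGaussSum, incGaussSum, mul_sum, mul_sum]
    congr 1
    · refine sum_congr rfl fun α hα => ?_
      rw [weilS_of_mem_setX hF hk hkn hα, heta α ((mem_setX_iff hF hk hkn u c a α).mp hα).1,
        mul_comm α]
      ring
    · refine sum_congr rfl fun α hα => ?_
      have hsol := hx α hα (hV hc α ((setVOdd_eq hp hk hF hodd u c a).symm ▸ hα)).exists
      -- The passage from `ε_p η(1-c)` to `μ_p η(c-1)` only absorbs `η(-1)`, so both sums carry the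
      -- same constant.
      have hmu : muP p n * etaChar (c - 1) = epsP p n * etaChar (1 - c) := by
        rw [hneg, ← etaChar_neg_one_mul_muP (F := F) hp hF]
        linear_combination -(muP p n * etaChar (c - 1)) *
          etaChar_mul_self (neg_ne_zero.mpr (one_ne_zero (α := F)))
      rw [chiOne_mul_weilS_of_isSolL hsol, heta α ((mem_setXbar_iff hF hk hkn u c a α).mp hα).1,
        mul_comm α]
      linear_combination -((-1) ^ (n - 1) * (√((p : ℝ) ^ n) : ℂ) * etaChar α *
        chiOne p (deltaC p n k u c a b x α * α)) * hmu

end Assembly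

end

/-- The family `x` is any choice of solutions `x_α` of `L_α(y) = B_α^{p^k}`, for those `α` outside
`X_a` where the equation is solvable. -/
theorem theorem8 (p n k : ℕ) [Fact p.Prime] (hp : Odd p) (hn : 2 ≤ n) (hk : 1 ≤ k) (hkn : k < n)
    {F : Type*} [Field F] [Fintype F] [Algebra (ZMod p) F] (hF : Fintype.card F = p ^ n)
    (u : ℕ → F) (a b c : F) (x : F → F)
    (hx : ∀ α ∈ setXbar p n k u c a,
      (∃ y : F, IsSolL p n k u c a α y) → IsSolL p n k u c a α (x α)) :
    (cDDT (pertGold p n k u) c a b : ℂ) = 1 + ((p : ℂ) ^ n)⁻¹ * sumT p n k u c a b ∧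
    -- case (i)
    (Even (n / n.gcd k) → c ≠ 1 → ∀ m : ℕ, n = 2 * m →
      (∀ α ∈ setVEven p n k u c a, ∃! y : F, IsSolL p n k u c a α y) ∧
      sumT p n k u c a b =
        (-1) ^ (m / n.gcd k) * (p : ℂ) ^ m * sigmaX p n k u c a b
        + (-1) ^ (m / n.gcd k + 1) * (p : ℂ) ^ m * sigmaOne p n k u c a b
            * ((p : ℂ) ^ n.gcd k + 1)
        + (-1) ^ (m / n.gcd k) * (p : ℂ) ^ m *
            ∑ α ∈ setVEven p n k u c a, chiOne p (α * deltaC p n k u c a b x α)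
        + (-1) ^ (m / n.gcd k + 1) * (p : ℂ) ^ (m + n.gcd k) *
            ∑ α ∈ setSolvable p n k u c a, chiOne p (α * deltaC p n k u c a b x α)) ∧
    -- case (ii)
    (Odd (n / n.gcd k) → (c ≠ 1 ∨ a ≠ 0) →
      (c ≠ 1 → ∀ α ∈ setVOdd p n k u c a, ∃! y : F, IsSolL p n k u c a α y) ∧
      sumT p n k u c a b =
        (-1) ^ (n - 1) * epsP p n * (Real.sqrt ((p : ℝ) ^ n) : ℂ) * etaChar (1 - c) *
            incGaussSum (setX p n k u c a) etaChar
              (fun α => chiOne p ((pPrime p n k u a - b) * α))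
        + (-1) ^ (n - 1) * muP p n * (Real.sqrt ((p : ℝ) ^ n) : ℂ) * etaChar (c - 1) *
            incGaussSum (setVOdd p n k u c a) etaChar
              (fun α => chiOne p (deltaC p n k u c a b x α * α))) ∧
    -- the degenerate value `c = 1`
    (c = 1 → sumT p n k u c a b = (p : ℂ) ^ n * sigmaX p n k u c a b) :=
  ⟨cDDT_eq hF hk hkn u a b c,
    fun heven hc _ hm => sumT_of_even hp hk hkn hF u a b c x hx heven hc hm,
    sumT_of_odd hp hk hkn hF u a b c x hx,
    fun hc => by subst hc; exact sumT_of_eq_one hF hk hkn u a b⟩
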